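/- All graphs are finite and simple; the null graph (no vertices) is allowed and counts as connected. A \emph{model} of a graph $H$ in a graph $G$ is a family $(B_x)_{x\in V(H)}$ of pairwise disjoint subsets of $V(G)$ such that every $B_x$ induces a non-empty connected subgraph of $G$, and for every edge $xy$ of $H$ there is an edge of $G$ between $B_x$ and $B_y$. $G$ is \emph{$H$-minor-free} if it contains no model of $H$. A graph is an \emph{apex-forest} if it can be made acyclic by the removal of at most one vertex. A \emph{path decomposition} of $G$ is a sequence $(W_1,\dots,W_m)$, $m\ge 1$, of subsets of $V(G)$ (bags) such that every edge of $G$ has both ends in some common bag, and for every vertex $v$ of $G$ the set $\{i : v\in W_i\}$ is a non-empty set of consecutive integers. Its \emph{width} is $\max_i |W_i|-1$, and the \emph{pathwidth} $\operatorname{pw}(G)$ is the minimum width of a path decomposition of $G$. The \emph{diameter} $\operatorname{diam}(G)$ of a connected graph $G$ is the maximum distance between two of its vertices (and $0$ if $G$ is null). Let $X$ be an apex-forest with at least two vertices and let $G$ be a connected graph. If $G$ is $X$-minor-free, then $$\operatorname{pw}(G)\le (2|V(X)|-3)(\operatorname{diam}(G)+1)-1.$$ -/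

import Mathlib

namespace SimpleGraph

/-- A family of pairwise disjoint branch sets of `G`, indexed by the vertices of `H`, is a model
of `H` in `G` if every branch set induces a (non-empty) connected subgraph of `G` and every edge
`xy` of `H` is witnessed by an edge of `G` between the branch sets of `x` and `y`. -/
structure IsModel {W V : Type*} (H : SimpleGraph W) (G : SimpleGraph V) (B : W → Set V) :
    Prop where
  disjoint : ∀ x y : W, x ≠ y → Disjoint (B x) (B y)
  connected : ∀ x : W, (G.induce (B x)).Connected
  adj : ∀ x y : W, H.Adj x y → ∃ u ∈ B x, ∃ v ∈ B y, G.Adj u v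

/-- `H` is a minor of `G`. -/
def IsMinor {W V : Type*} (H : SimpleGraph W) (G : SimpleGraph V) : Prop :=
  ∃ B : W → Set V, IsModel H G B

/-- `G` is `H`-minor-free. -/
def MinorFree {W V : Type*} (H : SimpleGraph W) (G : SimpleGraph V) : Prop :=
  ¬ IsMinor H G

/-- A graph is an apex-forest if it can be made acyclic by removing at most one vertex. -/
def IsApexForest {V : Type*} (X : SimpleGraph V) : Prop :=
  ∃ S : Set V, S.Subsingleton ∧ (X.induce Sᶜ).IsAcyclic

/-- A path decomposition of `G`, with bags indexed by the vertices of the path on `m + 1`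
vertices (so that the path is never null): every edge lies in a bag, and for every vertex `v` the
indices of the bags that contain `v` induce a non-empty connected subgraph of that path. -/
structure PathDecomposition {V : Type*} (G : SimpleGraph V) where
  m : ℕ
  bag : Fin (m + 1) → Finset V
  edge_mem_bag : ∀ u v : V, G.Adj u v → ∃ i, u ∈ bag i ∧ v ∈ bag i
  connected : ∀ v : V, ((pathGraph (m + 1)).induce {i | v ∈ bag i}).Connected

/-- The width of a path decomposition: the maximum size of a bag, minus one. It is an integer,
since it may be `-1` for the null graph. -/
def PathDecomposition.width {V : Type*} {G : SimpleGraph V} (D : PathDecomposition G) : ℤ :=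
  ((Finset.univ.sup fun i => (D.bag i).card : ℕ) : ℤ) - 1

/-- The pathwidth of a (finite) graph: the minimum width of a path decomposition. -/
noncomputable def pathwidth {V : Type*} (G : SimpleGraph V) : ℤ :=
  sInf (Set.range fun D : PathDecomposition G => D.width)

/-- For a finite graph the minimum in the definition of the pathwidth is attained. -/
theorem isLeast_pathwidth {V : Type*} [Finite V] (G : SimpleGraph V) :
    IsLeast (Set.range fun D : PathDecomposition G => D.width) (pathwidth G) := by
  have : Fintype V := Fintype.ofFinite V
  have hb : BddBelow (Set.range fun D : PathDecomposition G => D.width) := by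
    refine ⟨-1, ?_⟩
    rintro _ ⟨D, rfl⟩
    simp only [PathDecomposition.width]
    omega
  have hn : (Set.range fun D : PathDecomposition G => D.width).Nonempty := by
    refine ⟨_, ⟨⟨0, fun _ => Finset.univ, fun _ _ _ => ⟨0, by simp⟩, fun v => ?_⟩, rfl⟩⟩
    have : Nonempty {i : Fin (0 + 1) | v ∈ (Finset.univ : Finset V)} := ⟨⟨0, by simp⟩⟩
    refine ⟨fun a b => ?_⟩
    have : a = b := Subtype.ext (Subsingleton.elim (α := Fin 1) _ _)
    rw [this]
  exact ⟨Int.csInf_mem hn hb, fun _ h => csInf_le hb h⟩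

end SimpleGraph

/-! Remove an apex `a` from `X` and enlarge the remaining forest to a tree `F` on the same vertices.
Let `C` be a set of vertices of `G` whose complement is connected and non-empty. A model of `F` in
`G[C]` whose branch sets all meet the boundary of `C` would give a model of `X`, with the complement
of `C` as branch set of `a` (`isMinor_of_rooted`). So no such rooted model exists.

The core is a rooted form of the excluded-tree theorem for pathwidth (`good_univ_of_not_rooted`). A
partial model of `F` grows along separations of minimum order, with `menger` extending its branch
sets. If it never becomes a rooted model, the process yields a path decomposition of `G[C]` and a
focus `H` containing the boundary of `C`, such that each bag has at most `2|F| - 1` vertices of `H`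
and each vertex outside `H` lies in a single bag.

For `H` of minimum size, every component of `C \ H` again has a connected complement
(`IsFocused.connSet_compl_compSet`), so the argument recurses into the components. Each component
sits in one bag, where its own decomposition is inserted (`IsFocused.exists_isLayered`). The
successive foci form layers. Starting from the complement of a vertex `r`, the layer of a vertex is
at most its distance from `r`, so there are at most `diam + 1` layers, each contributing at most
`2|F| - 1 = 2|X| - 3` vertices to a bag (`IsLayered.pathwidth_le`). -/

namespace SimpleGraph

variable {V W : Type*}

/-! ### Connected sets -/

/-- A set is connected in `G` if it has no proper non-empty part closed under adjacency. The empty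
set is included. -/
def ConnSet (G : SimpleGraph V) (s : Set V) : Prop :=
  ∀ u ∈ s, ∀ t : Set V, u ∈ t → (∀ a ∈ t, a ∈ s → ∀ b ∈ s, G.Adj a b → b ∈ t) → s ⊆ t

theorem ConnSet.mono {G G' : SimpleGraph V} (h : G ≤ G') {s : Set V} (hs : G.ConnSet s) :
    G'.ConnSet s :=
  fun u hu t hut ht => hs u hu t hut fun a ha has b hb hab => ht a ha has b hb (h hab)

theorem connSet_singleton (G : SimpleGraph V) (v : V) : G.ConnSet {v} := by
  rintro u rfl t hut - w rfl
  exact hut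

theorem connSet_empty (G : SimpleGraph V) : G.ConnSet ∅ := fun _ hu => absurd hu (by simp)

theorem ConnSet.union_of_adj {G : SimpleGraph V} {s s' : Set V} (hs : G.ConnSet s)
    (hs' : G.ConnSet s') {x y : V} (hx : x ∈ s) (hy : y ∈ s') (hxy : x = y ∨ G.Adj x y) :
    G.ConnSet (s ∪ s') := by
  intro u hu t hut ht
  have h1 : ∀ v ∈ s, v ∈ t → s ⊆ t := fun v hv hvt =>
    hs v hv t hvt fun a ha has b hb hab => ht a ha (Or.inl has) b (Or.inl hb) hab
  have h2 : ∀ v ∈ s', v ∈ t → s' ⊆ t := fun v hv hvt =>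
    hs' v hv t hvt fun a ha has b hb hab => ht a ha (Or.inr has) b (Or.inr hb) hab
  have h3 : x ∈ t ↔ y ∈ t := by
    rcases hxy with rfl | hxy
    · rfl
    · exact ⟨fun h => ht x h (Or.inl hx) y (Or.inr hy) hxy,
        fun h => ht y h (Or.inr hy) x (Or.inl hx) hxy.symm⟩
  rcases hu with hu | hu
  · have h4 := h1 u hu hut
    exact Set.union_subset h4 (h2 y hy (h3.1 (h4 hx)))
  · have h4 := h2 u hu hut
    exact Set.union_subset (h1 x hx (h3.2 (h4 hy))) h4

theorem ConnSet.union {G : SimpleGraph V} {s s' : Set V} (hs : G.ConnSet s)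
    (hs' : G.ConnSet s') {x : V} (hx : x ∈ s) (hx' : x ∈ s') : G.ConnSet (s ∪ s') :=
  hs.union_of_adj hs' hx hx' (Or.inl rfl)

theorem ConnSet.preconnected_induce {G : SimpleGraph V} {s : Set V} (hs : G.ConnSet s) :
    (G.induce s).Preconnected := by
  intro u v
  have := hs u u.2 {w | ∃ h : w ∈ s, (G.induce s).Reachable u ⟨w, h⟩} ⟨u.2, Reachable.refl _⟩
    (fun a ha has b hb hab => by
      obtain ⟨h, hr⟩ := ha
      exact ⟨hb, hr.trans (Adj.reachable (by simpa using hab))⟩) v.2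
  exact this.2

theorem ConnSet.connected_induce {G : SimpleGraph V} {s : Set V} (hs : G.ConnSet s)
    (hne : s.Nonempty) : (G.induce s).Connected :=
  have : Nonempty s := hne.to_subtype
  ⟨hs.preconnected_induce⟩

theorem connSet_univ {G : SimpleGraph V} (h : G.Preconnected) : G.ConnSet Set.univ := by
  intro u _ t hut ht v _
  obtain ⟨p⟩ := h u v
  replace ht : ∀ a ∈ t, ∀ b, G.Adj a b → b ∈ t := fun a ha b => ht a ha trivial b trivial
  clear * - p hut ht
  induction p with
  | nil => exact hut
  | cons hab _ ih => exact ih (ht _ hut _ hab)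

/-- The spanning subgraph of `G` whose edges are the edges of `G` with both ends in `R`. -/
def inside (G : SimpleGraph V) (R : Set V) : SimpleGraph V where
  Adj u v := G.Adj u v ∧ u ∈ R ∧ v ∈ R
  symm := ⟨fun _ _ h => ⟨h.1.symm, h.2.2, h.2.1⟩⟩
  loopless := ⟨fun _ h => G.irrefl h.1⟩

theorem inside_le (G : SimpleGraph V) (R : Set V) : G.inside R ≤ G := fun _ _ h => h.1

theorem ConnSet.subset_of_inside {G : SimpleGraph V} {R s : Set V} (hs : (G.inside R).ConnSet s)
    {u : V} (hu : u ∈ s) (huR : u ∈ R) : s ⊆ R :=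
  hs u hu R huR fun _ _ _ _ _ hab => hab.2.2

/-! ### Linkages and Menger's theorem -/

/-- There are `k` disjoint connected sets that meet both `A` and `B`. -/
def HasLinkage (G : SimpleGraph V) (A B : Set V) (k : ℕ) : Prop :=
  ∃ (I : Set V) (g : V → Set V), I.ncard = k ∧ (∀ i ∈ I, ∀ j ∈ I, i ≠ j → Disjoint (g i) (g j)) ∧
    ∀ i ∈ I, G.ConnSet (g i) ∧ (g i ∩ A).Nonempty ∧ (g i ∩ B).Nonempty

/-- `g` assigns to the vertices of `A` disjoint connected sets that contain them and meet `B`. -/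
def IsLinkage (G : SimpleGraph V) (A B : Set V) (g : V → Set V) : Prop :=
  (∀ i ∈ A, ∀ j ∈ A, i ≠ j → Disjoint (g i) (g j)) ∧
    ∀ i ∈ A, G.ConnSet (g i) ∧ i ∈ g i ∧ (g i ∩ B).Nonempty

/-- Disjoint sets have distinct representatives in `A`, so `A.ncard` of them use up all of `A` and
can be indexed by their representatives. -/
theorem HasLinkage.exists_isLinkage [Finite V] {G : SimpleGraph V} {A B : Set V}
    (h : G.HasLinkage A B A.ncard) : ∃ g, G.IsLinkage A B g := by
  classical
  obtain ⟨I, g, hI, hd, hg⟩ := h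
  choose! f hf using fun i hi => (hg i hi).2.1
  have hinj : Set.InjOn f I := by
    intro i hi j hj hij
    by_contra hne
    exact Set.disjoint_left.1 (hd i hi j hj hne) (hf i hi).1 (hij ▸ (hf j hj).1)
  have hsub : f '' I ⊆ A := by
    rintro _ ⟨i, hi, rfl⟩
    exact (hf i hi).2
  have himg : f '' I = A :=
    Set.eq_of_subset_of_ncard_le hsub (by rw [hinj.ncard_image, hI]) (Set.toFinite _)
  have hsurj : ∀ a ∈ A, ∃ i ∈ I, f i = a := fun a ha => by rwa [← himg] at ha
  choose! e heI hef using hsurj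
  refine ⟨fun a => g (e a), fun a ha b hb hab => hd _ (heI a ha) _ (heI b hb) ?_, fun a ha => ?_⟩
  · intro h
    apply hab
    rw [← hef a ha, ← hef b hb, h]
  · have := hg _ (heI a ha)
    refine ⟨this.1, ?_, this.2.2⟩
    have h2 := (hf _ (heI a ha)).1
    rwa [hef a ha] at h2

theorem HasLinkage.symm {G : SimpleGraph V} {A B : Set V} {k : ℕ} (h : G.HasLinkage A B k) :
    G.HasLinkage B A k := by
  obtain ⟨I, g, hI, hd, hg⟩ := h
  exact ⟨I, g, hI, hd, fun i hi => ⟨(hg i hi).1, (hg i hi).2.2, (hg i hi).2.1⟩⟩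

/-- `(M, N)` is a separation of `G` that separates `A` from `B`. -/
structure Separates (G : SimpleGraph V) (A B M N : Set V) : Prop where
  cover : ∀ v, v ∈ M ∨ v ∈ N
  left : A ⊆ M
  right : B ⊆ N
  not_adj : ∀ u ∈ M, u ∉ N → ∀ v ∈ N, v ∉ M → ¬ G.Adj u v

theorem Separates.symm {G : SimpleGraph V} {A B M N : Set V} (h : G.Separates A B M N) :
    G.Separates B A N M :=
  ⟨fun v => (h.cover v).symm, h.right, h.left,
    fun u hu hu' v hv hv' huv => h.not_adj v hv hv' u hu hu' huv.symm⟩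

/-- If `(M, N)` separates `A` from `B` in `G` minus the edge `xy`, then every separation of `A` from
`(M ∩ N) ∪ {x}` inside `M` yields a separation of `A` from `B` of at most the same order. -/
theorem Separates.le_ncard_of_deleteEdge [Finite V] {G G' : SimpleGraph V} {A B M N : Set V}
    {x y : V} {k : ℕ} (hG : ∀ u v, G.Adj u v → G'.Adj u v ∨ s(u, v) = s(x, y))
    (hk : ∀ M N, G.Separates A B M N → k ≤ (M ∩ N).ncard) (h : G'.Separates A B M N)
    (hyM : y ∉ M) {M₁ N₁ : Set V}
    (h₁ : (G'.inside M).Separates A (insert x (M ∩ N)) M₁ N₁) : k ≤ (M₁ ∩ N₁).ncard := by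
  -- The edge `xy` cannot cross this separation, because `x ∈ N₁` and `y ∉ M`.
  have hs : G.Separates A B (M₁ ∩ M) (N₁ ∪ N) := by
    refine ⟨fun v => ?_, fun a ha => ⟨h₁.left ha, h.left ha⟩, fun b hb => Or.inr (h.right hb), ?_⟩
    · rcases h.cover v with hv | hv
      · rcases h₁.cover v with hv' | hv'
        · exact Or.inl ⟨hv', hv⟩
        · exact Or.inr (Or.inl hv')
      · exact Or.inr (Or.inr hv)
    · rintro u ⟨huM₁, huM⟩ huN v hvN hvM huv
      simp only [Set.mem_union, not_or] at huN
      have hux : u ≠ x := by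
        rintro rfl
        exact huN.1 (h₁.right (Set.mem_insert _ _))
      have huv' : G'.Adj u v := by
        rcases hG u v huv with h' | h'
        · exact h'
        · rw [Sym2.eq_iff] at h'
          rcases h' with h' | h'
          · exact absurd h'.1 hux
          · exact absurd (h'.1 ▸ huM) hyM
      have hvM' : v ∈ M := by
        by_contra hv
        exact h.not_adj u huM huN.2 v ((h.cover v).resolve_left hv) hv huv'
      have hv₁ : v ∉ M₁ := fun hv => hvM ⟨hv, hvM'⟩
      exact h₁.not_adj u huM₁ huN.1 v ((h₁.cover v).resolve_left hv₁) hv₁ ⟨huv', huM, hvM'⟩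
  refine (hk _ _ hs).trans (Set.ncard_le_ncard ?_ (Set.toFinite _))
  rintro v ⟨⟨h1, h2⟩, h3 | h3⟩
  · exact ⟨h1, h3⟩
  · exact ⟨h1, h₁.right (Set.mem_insert_of_mem _ ⟨h2, h3⟩)⟩

/-- Without edges, `(A, Aᶜ ∪ B)` is a separation of order `|A ∩ B|`, and the vertices of `A ∩ B`
serve as trivial paths. -/
theorem hasLinkage_bot [Finite V] {G : SimpleGraph V} {A B : Set V} {k : ℕ}
    (hG : ∀ u v, ¬ G.Adj u v) (hk : ∀ M N, G.Separates A B M N → k ≤ (M ∩ N).ncard) :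
    G.HasLinkage A B k := by
  have h1 : G.Separates A B A (Aᶜ ∪ B) :=
    ⟨fun v => by by_cases hv : v ∈ A <;> simp [hv], subset_rfl, Set.subset_union_right,
      fun u _ _ v _ _ => hG u v⟩
  have h2 := hk _ _ h1
  obtain ⟨I, hI, hIk⟩ := Set.exists_subset_card_eq h2
  refine ⟨I, fun v => {v}, hIk, fun i _ j _ hij => by simpa using hij, fun i hi => ?_⟩
  have := hI hi
  refine ⟨connSet_singleton G i, ⟨i, rfl, this.1⟩, ⟨i, rfl, this.2.resolve_left fun h => h this.1⟩⟩

/-- **Menger's theorem**, with connected sets in place of paths. -/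
theorem menger [Finite V] (G : SimpleGraph V) (A B : Set V) (k : ℕ)
    (hk : ∀ M N, G.Separates A B M N → k ≤ (M ∩ N).ncard) : G.HasLinkage A B k := by
  classical
  induction hn : G.edgeSet.ncard using Nat.strong_induction_on generalizing G A B with
  | _ n ih =>
  by_cases hE : ∀ u v, ¬ G.Adj u v
  · exact hasLinkage_bot hE hk
  push Not at hE
  obtain ⟨x, y, hxy⟩ := hE
  set G' := G.deleteEdges {s(x, y)} with hG'
  have hle : G' ≤ G := deleteEdges_le _
  have hGG' : ∀ u v, G.Adj u v → G'.Adj u v ∨ s(u, v) = s(x, y) := by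
    intro u v huv
    by_cases h : s(u, v) = s(x, y)
    · exact Or.inr h
    · left
      rw [hG', deleteEdges_adj]
      exact ⟨huv, h⟩
  have hxy' : ¬ G'.Adj x y := by simp [hG', deleteEdges_adj]
  have hlt : ∀ H ≤ G', H.edgeSet.ncard < n := by
    intro H hH
    rw [← hn]
    refine Set.ncard_lt_ncard ⟨edgeSet_mono (hH.trans hle), fun h => ?_⟩ (Set.toFinite _)
    exact hxy' (hH (h (show s(x, y) ∈ G.edgeSet from hxy)))
  -- Induction on the number of edges. If deleting `xy` creates a separation of order below `k`,
  -- then `xy` crosses it, and linkages on its two sides are glued along `M ∩ N` and the edge `xy`.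
  by_cases hk' : ∀ M N, G'.Separates A B M N → k ≤ (M ∩ N).ncard
  · obtain ⟨I, g, hI, hd, hg⟩ := ih _ (hlt G' le_rfl) G' A B hk' rfl
    exact ⟨I, g, hI, hd, fun i hi => ⟨(hg i hi).1.mono hle, (hg i hi).2⟩⟩
  push Not at hk'
  obtain ⟨M, N, hMN, hlt'⟩ := hk'
  wlog hxM : x ∈ M ∧ x ∉ N ∧ y ∈ N ∧ y ∉ M generalizing x y
  · by_cases hyM : y ∈ M ∧ y ∉ N ∧ x ∈ N ∧ x ∉ M
    · have h3 : s(y, x) = s(x, y) := Sym2.eq_swap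
      refine this y x hxy.symm ?_ ?_ ?_ ?_ ?_ ?_ hyM <;> simp only [h3] <;>
      first | assumption | exact fun h => hxy' h.symm
    · exfalso
      have : G.Separates A B M N := by
        refine ⟨hMN.cover, hMN.left, hMN.right, fun u hu hu' v hv hv' huv => ?_⟩
        rcases hGG' u v huv with h | h
        · exact hMN.not_adj u hu hu' v hv hv' h
        · rw [Sym2.eq_iff] at h
          rcases h with ⟨rfl, rfl⟩ | ⟨rfl, rfl⟩
          · exact hxM ⟨hu, hu', hv, hv'⟩
          · exact hyM ⟨hu, hu', hv, hv'⟩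
      exact absurd (hk _ _ this) (by omega)
  obtain ⟨hxM, hxN, hyN, hyM⟩ := hxM
  have hxS : x ∉ M ∩ N := fun h => hxN h.2
  have hyS : y ∉ M ∩ N := fun h => hyM h.1
  have hcard : (insert x (M ∩ N)).ncard = k := by
    rw [Set.ncard_insert_of_notMem hxS (Set.toFinite _)]
    refine le_antisymm hlt' ?_
    have : G.Separates A B M (insert x N) := by
      refine ⟨fun v => (hMN.cover v).imp_right (Set.mem_insert_of_mem _), hMN.left,
        hMN.right.trans (Set.subset_insert _ _), fun u hu hu' v hv hv' huv => ?_⟩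
      simp only [Set.mem_insert_iff, not_or] at hu' hv
      have hvN := hv.resolve_left fun h => hv' (h ▸ hxM)
      rcases hGG' u v huv with h | h
      · exact hMN.not_adj u hu hu'.2 v hvN hv' h
      · rw [Sym2.eq_iff] at h
        rcases h with ⟨rfl, rfl⟩ | ⟨rfl, rfl⟩
        · exact hu'.1 rfl
        · exact hyM hu
    refine (hk _ _ this).trans ?_
    rw [← Set.ncard_insert_of_notMem hxS (Set.toFinite _)]
    refine Set.ncard_le_ncard ?_ (Set.toFinite _)
    rintro v ⟨h1, rfl | h2⟩
    · exact Set.mem_insert _ _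
    · exact Set.mem_insert_of_mem _ ⟨h1, h2⟩
  have hcard' : (insert y (N ∩ M)).ncard = k := by
    rw [Set.inter_comm N M, Set.ncard_insert_of_notMem hyS (Set.toFinite _), ← hcard,
      Set.ncard_insert_of_notMem hxS (Set.toFinite _)]
  have hL := ih _ (hlt _ (inside_le G' M)) (G'.inside M) A (insert x (M ∩ N))
    (fun M₁ N₁ h₁ => hMN.le_ncard_of_deleteEdge hGG' hk hyM h₁) rfl
  have hR := ih _ (hlt _ (inside_le G' N)) (G'.inside N) B (insert y (N ∩ M))
    (fun M₁ N₁ h₁ => hMN.symm.le_ncard_of_deleteEdge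
      (fun u v huv => (hGG' u v huv).imp_right fun h => h.trans Sym2.eq_swap)
      (fun P Q h => by rw [Set.inter_comm]; exact hk _ _ h.symm) hxN h₁) rfl
  obtain ⟨C, hCd, hC⟩ :=
    (show HasLinkage _ _ _ (Set.ncard _) from hcard.symm ▸ hL.symm).exists_isLinkage
  obtain ⟨D, hDd, hD⟩ :=
    (show HasLinkage _ _ _ (Set.ncard _) from hcard'.symm ▸ hR.symm).exists_isLinkage
  rw [Set.inter_comm N M] at hDd hD
  have hPM : insert x (M ∩ N) ⊆ M := Set.insert_subset hxM Set.inter_subset_left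
  have hQN : insert y (M ∩ N) ⊆ N := Set.insert_subset hyN Set.inter_subset_right
  have hCM : ∀ p ∈ insert x (M ∩ N), C p ⊆ M := fun p hp =>
    (hC p hp).1.subset_of_inside (hC p hp).2.1 (hPM hp)
  have hDN : ∀ q ∈ insert y (M ∩ N), D q ⊆ N := fun q hq =>
    (hD q hq).1.subset_of_inside (hD q hq).2.1 (hQN hq)
  -- `σ` says which set on the `N` side continues the set at `p`: across `xy` at `x`, and at the
  -- same vertex otherwise.
  set σ : V → V := fun p => if p = x then y else p with hσ
  have hσx : σ x = y := by simp [hσ]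
  have hσS : ∀ p ∈ M ∩ N, σ p = p := fun p hp => by
    have : p ≠ x := fun h => hxS (h ▸ hp)
    simp [hσ, this]
  have hσQ : ∀ p ∈ insert x (M ∩ N), σ p ∈ insert y (M ∩ N) := by
    rintro p (rfl | hp)
    · rw [hσx]; exact Set.mem_insert _ _
    · rw [hσS p hp]; exact Set.mem_insert_of_mem _ hp
  have hσinj : ∀ p ∈ insert x (M ∩ N), ∀ q ∈ insert x (M ∩ N), σ p = σ q → p = q := by
    rintro p (rfl | hp) q (rfl | hq) h
    · rfl
    · rw [hσx, hσS q hq] at h; exact absurd (h ▸ hq) hyS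
    · rw [hσx, hσS p hp] at h; exact absurd (h ▸ hp) hyS
    · rwa [hσS p hp, hσS q hq] at h
  -- The two sides meet only in `M ∩ N`, each vertex of which already lies in the sets `C` and `D`
  -- that it indexes.
  have hCD : ∀ p ∈ insert x (M ∩ N), ∀ q ∈ insert x (M ∩ N), p ≠ q →
      Disjoint (C p) (D (σ q)) := by
    intro p hp q hq hpq
    rw [Set.disjoint_left]
    intro w hw hw'
    have hwS : w ∈ M ∩ N := ⟨hCM p hp hw, hDN _ (hσQ q hq) hw'⟩
    have hwP := Set.mem_insert_of_mem x hwS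
    have hwQ := Set.mem_insert_of_mem y hwS
    have h1 : p = w := by
      by_contra hne
      exact Set.disjoint_left.1 (hCd p hp w hwP hne) hw (hC w hwP).2.1
    have h2 : σ q = w := by
      by_contra hne
      exact Set.disjoint_left.1 (hDd _ (hσQ q hq) w hwQ hne) hw' (hD w hwQ).2.1
    apply hpq
    apply hσinj p hp q hq
    rw [h2, h1, hσS w hwS]
  refine ⟨insert x (M ∩ N), fun p => C p ∪ D (σ p), hcard, fun p hp q hq hpq => ?_, fun p hp => ?_⟩
  · rw [Set.disjoint_union_left, Set.disjoint_union_right, Set.disjoint_union_right]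
    exact ⟨⟨hCd p hp q hq hpq, hCD p hp q hq hpq⟩, (hCD q hq p hp hpq.symm).symm,
      hDd _ (hσQ p hp) _ (hσQ q hq) fun h => hpq (hσinj p hp q hq h)⟩
  · obtain ⟨c1, c2, a, ha, ha'⟩ := hC p hp
    obtain ⟨d1, d2, b, hb, hb'⟩ := hD _ (hσQ p hp)
    refine ⟨?_, ⟨a, Or.inl ha, ha'⟩, ⟨b, Or.inr hb, hb'⟩⟩
    refine (c1.mono ((inside_le _ _).trans hle)).union_of_adj
      (d1.mono ((inside_le _ _).trans hle)) c2 d2 ?_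
    rcases hp with rfl | hp
    · rw [hσx]; exact Or.inr hxy
    · rw [hσS p hp]; exact Or.inl rfl

/-! ### Separations given by a set and its boundary -/

/-- `Z ⊆ A` contains all vertices of `A` that have a neighbour outside `A`. -/
def IsSep (G : SimpleGraph V) (A Z : Set V) : Prop :=
  Z ⊆ A ∧ ∀ u ∈ A, u ∉ Z → ∀ v, G.Adj u v → v ∈ A

/-- If no separation between `P` and `A` has smaller order than `(P, T)`, then `T` is linked outside
`P` to the boundary of `A`. The set `Y` contains this boundary, and the condition on `Y` further
restricts the separations to be considered. -/
theorem exists_linkage_of_minimal [Finite V] {G : SimpleGraph V} {P T A Y : Set V}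
    (hP : G.IsSep P T) (hPA : P ⊆ A) (hAY : ∀ u ∈ A, u ∉ Y → ∀ v, G.Adj u v → v ∈ A)
    (hmin : ∀ P' T', G.IsSep P' T' → P ⊆ P' → P' ⊆ A → T' ∩ P ⊆ T → Y ∩ (P' \ P) ⊆ T' →
      T.ncard ≤ T'.ncard) :
    ∃ g : V → Set V, G.IsLinkage T Y g ∧ ∀ t ∈ T, g t ⊆ A ∧ g t ∩ P ⊆ {t} := by
  -- Working inside `R` forces the linkage to meet `P` only in `T`.
  set R := A \ (P \ T) with hR
  have hTR : T ⊆ R := fun t ht => ⟨hPA (hP.1 ht), fun h => h.2 ht⟩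
  have hRP : ∀ v ∈ R, v ∈ P → v ∈ T := fun v hv hvP => by
    by_contra h
    exact hv.2 ⟨hvP, h⟩
  have hk : ∀ M N, (G.inside R).Separates T (Y ∩ R) M N → T.ncard ≤ (M ∩ N).ncard := by
    intro M N h
    -- A Menger separation inside `R`, with `P` put back, competes with `(P, T)`.
    have h1 : G.IsSep (P ∪ M ∩ R) (M ∩ N ∩ R) := by
      refine ⟨fun v hv => Or.inr ⟨hv.1.1, hv.2⟩, fun u hu hu' v huv => ?_⟩
      by_cases huR : u ∈ R
      · have huM : u ∈ M := by
          rcases hu with hu | hu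
          · exact h.left (hRP u huR hu)
          · exact hu.1
        have huN : u ∉ N := fun hN => hu' ⟨⟨huM, hN⟩, huR⟩
        have hvA : v ∈ A := hAY u huR.1 (fun hY => huN (h.right ⟨hY, huR⟩)) v huv
        by_contra hv
        simp only [Set.mem_union, not_or] at hv
        have hvR : v ∈ R := ⟨hvA, fun h => hv.1 h.1⟩
        have hvM : v ∉ M := fun hM => hv.2 ⟨hM, hvR⟩
        exact h.not_adj u huM huN v ((h.cover v).resolve_left hvM) hvM ⟨huv, huR, hvR⟩
      · have huP : u ∈ P := hu.resolve_right fun h => huR h.2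
        exact Or.inl (hP.2 u huP (fun hT => huR (hTR hT)) v huv)
    refine (hmin _ _ h1 Set.subset_union_left (Set.union_subset hPA fun v hv => hv.2.1) ?_ ?_).trans
      (Set.ncard_le_ncard Set.inter_subset_left (Set.toFinite _))
    · rintro v ⟨hv, hvP⟩
      exact hRP v hv.2 hvP
    · rintro v ⟨hvY, hv, hvP⟩
      have hv := hv.resolve_left hvP
      exact ⟨⟨hv.1, h.right ⟨hvY, hv.2⟩⟩, hv.2⟩
  obtain ⟨g, hgd, hg⟩ := (menger _ _ _ _ hk).exists_isLinkage
  refine ⟨g, ⟨hgd, fun t ht => ⟨(hg t ht).1.mono (inside_le _ _), (hg t ht).2.1,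
    (hg t ht).2.2.mono fun v hv => ⟨hv.1, hv.2.1⟩⟩⟩, fun t ht => ?_⟩
  have hgR : g t ⊆ R := (hg t ht).1.subset_of_inside (hg t ht).2.1 (hTR ht)
  refine ⟨fun v hv => (hgR hv).1, fun v hv => ?_⟩
  have hvT := hRP v (hgR hv.1) hv.2
  by_contra hne
  exact Set.disjoint_left.1 (hgd v hvT t ht hne) (hg v hvT).2.1 hv.1

/-! ### Focused path decompositions -/

/-- Interval representation of a path decomposition of `G[A]`, focused on a set `H` that contains
`S ∩ A`: every vertex outside `H` lies in exactly one bag, and every bag has at most `N` vertices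
in `H`. All bags have index at most `L`, and the bag at `L` contains `Z`. -/
structure IsFocused (G : SimpleGraph V) (S : Set V) (N : ℕ) (A Z : Set V) (lo hi : V → ℕ)
    (H : Set V) (L : ℕ) : Prop where
  subset : H ⊆ A
  focus : ∀ v ∈ A, v ∈ S → v ∈ H
  boundary : Z ⊆ H
  lo_le : ∀ v ∈ A, lo v ≤ hi v
  hi_le : ∀ v ∈ A, hi v ≤ L
  single : ∀ v ∈ A, v ∉ H → lo v = hi v
  last : ∀ v ∈ Z, hi v = L
  adj : ∀ u ∈ A, ∀ v ∈ A, G.Adj u v → lo u ≤ hi v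
  card : ∀ t, {v | v ∈ H ∧ lo v ≤ t ∧ t ≤ hi v}.ncard ≤ N

/-- `G[A]` has a path decomposition focused on `S ∩ A` with `Z` in the last bag, with at most `N`
relevant vertices in each bag. -/
def Good (G : SimpleGraph V) (S : Set V) (N : ℕ) (A Z : Set V) : Prop :=
  ∃ lo hi H L, G.IsFocused S N A Z lo hi H L

theorem Good.subset_boundary {G : SimpleGraph V} {S : Set V} {N : ℕ} {A Z Z' : Set V}
    (h : G.Good S N A Z) (hZ : Z' ⊆ Z) : G.Good S N A Z' := by
  obtain ⟨lo, hi, H, L, h⟩ := h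
  exact ⟨lo, hi, H, L, { h with
    boundary := hZ.trans h.boundary
    last := fun v hv => h.last v (hZ hv) }⟩

theorem good_empty (G : SimpleGraph V) (S : Set V) (N : ℕ) : G.Good S N ∅ ∅ :=
  ⟨fun _ => 0, fun _ => 0, ∅, 0, by constructor <;> simp⟩

/-- Appending a bag. -/
theorem Good.append [Finite V] {G : SimpleGraph V} {S : Set V} {N : ℕ} {A Z P T : Set V}
    (h : G.Good S N A Z) (hA : G.IsSep A Z) (hAP : A ⊆ P) (hTP : T ⊆ P)
    (hTA : T ∩ A ⊆ Z) (hS : S ∩ (P \ A) ⊆ T) (hN : (Z ∪ T).ncard ≤ N) : G.Good S N P T := by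
  classical
  obtain ⟨lo, hi, H, L, h⟩ := h
  have hZL : ∀ v ∈ Z, hi v = L := h.last
  -- The new bag `L + 1` holds `Z` and all of `P \ A`. Only `Z ∪ T` is counted there, since the
  -- vertices of `P \ A` outside `T` stay outside the focus.
  refine ⟨fun v => if v ∈ A then lo v else L + 1, fun v => if v ∈ A ∧ v ∉ Z then hi v else L + 1,
    H ∪ T, L + 1, ?_⟩
  have key : ∀ v ∈ A, lo v ≤ L := fun v hv => (h.lo_le v hv).trans (h.hi_le v hv)
  constructor
  · exact Set.union_subset (h.subset.trans hAP) hTP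
  · intro v hv hvS
    by_cases hvA : v ∈ A
    · exact Or.inl (h.focus v hvA hvS)
    · exact Or.inr (hS ⟨hvS, hv, hvA⟩)
  · exact Set.subset_union_right
  · intro v hv
    by_cases hvA : v ∈ A <;> by_cases hvZ : v ∈ Z <;> simp only [hvA, hvZ, if_true, if_false,
      not_true, not_false_eq_true, and_true, and_false]
    · exact (key v hvA).trans (Nat.le_succ _)
    · exact h.lo_le v hvA
    · exact le_rfl
    · exact le_rfl
  · intro v hv
    split_ifs with hc
    · exact (h.hi_le v hc.1).trans (Nat.le_succ _)
    · exact le_rfl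
  · intro v hv hvH
    simp only [Set.mem_union, not_or] at hvH
    have hvZ : v ∉ Z := fun hz => hvH.1 (h.boundary hz)
    by_cases hvA : v ∈ A
    · simp only [hvA, hvZ, if_true, not_false_eq_true, and_self]
      exact h.single v hvA hvH.1
    · simp [hvA]
  · intro v hv
    by_cases hvA : v ∈ A
    · have := hTA ⟨hv, hvA⟩
      simp [this]
    · simp [hvA]
  · intro u hu v hv huv
    split_ifs with huA hc hc
    · exact h.adj u huA v hc.1 huv
    · exact (key u huA).trans (Nat.le_succ _)
    · exact absurd (hA.2 v hc.1 hc.2 u huv.symm) huA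
    · exact le_rfl
  · intro t
    by_cases ht : t ≤ L
    · refine (Set.ncard_le_ncard ?_ (Set.toFinite _)).trans (h.card t)
      rintro v ⟨hvH, h1, h2⟩
      have hvA : v ∈ A := by
        by_contra hvA
        rw [if_neg hvA] at h1
        omega
      rw [if_pos hvA] at h1
      have hvH' : v ∈ H := hvH.elim id fun hT => h.boundary (hTA ⟨hT, hvA⟩)
      refine ⟨hvH', h1, ?_⟩
      by_cases hvZ : v ∈ Z
      · rwa [h.last v hvZ]
      · rwa [if_pos ⟨hvA, hvZ⟩] at h2
    · refine (Set.ncard_le_ncard ?_ (Set.toFinite _)).trans hN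
      rintro v ⟨hvH, h1, h2⟩
      by_cases hvA : v ∈ A
      · by_cases hvZ : v ∈ Z
        · exact Or.inl hvZ
        · rw [if_pos ⟨hvA, hvZ⟩] at h2
          have := h.hi_le v hvA
          omega
      · exact Or.inr (hvH.resolve_left fun hH => hvA (h.subset hH))

/-- A connected set that starts no later than `t` and contains a vertex of the last bag has a
vertex of the focus in the bag at `t`. -/
theorem IsFocused.exists_mem_bag {G : SimpleGraph V} {S : Set V} {N : ℕ} {A Z : Set V}
    {lo hi : V → ℕ} {H : Set V} {L : ℕ} (h : G.IsFocused S N A Z lo hi H L) {s : Set V}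
    (hs : G.ConnSet s) (hsA : s ⊆ A) {x z : V} (hx : x ∈ s) (hz : z ∈ s) (hzZ : z ∈ Z) {t : ℕ}
    (hxt : lo x ≤ t) (htL : t ≤ L) : ∃ y ∈ s, y ∈ H ∧ lo y ≤ t ∧ t ≤ hi y := by
  by_contra! hno
  -- Either alternative forces `hi v ≤ t`, so the neighbours of `v` in `s` also start by `t`. The
  -- property thus spreads over `s` up to `z`, which contradicts it.
  have key : ∀ v ∈ s, lo v ≤ t → hi v < t ∨ v ∉ H ∧ lo v ≤ t := fun v hv hvt => by
    by_cases hvH : v ∈ H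
    · exact Or.inl (hno v hv hvH hvt)
    · exact Or.inr ⟨hvH, hvt⟩
  have := hs x hx {v | hi v < t ∨ v ∉ H ∧ lo v ≤ t} (key x hx hxt) (fun a ha has b hb hab => by
    refine key b hb ?_
    have h1 := h.adj b (hsA hb) a (hsA has) hab.symm
    rcases ha with ha | ha
    · omega
    · have := h.single a (hsA has) ha.1
      omega) hz
  rcases this with h1 | h1
  · have := h.last z hzZ
    omega
  · exact h1.1 (h.boundary hzZ)

/-- A good set `A` restricts to a subset `P` whose boundary is linked outside `P` to the boundary
of `A`. -/
theorem Good.restrict [Finite V] {G : SimpleGraph V} {S : Set V} {N : ℕ} {A Z P T : Set V}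
    (h : G.Good S N A Z) (hPA : P ⊆ A) (hTP : T ⊆ P) {g : V → Set V} (hg : G.IsLinkage T Z g)
    (hgA : ∀ t ∈ T, g t ⊆ A ∧ g t ∩ P ⊆ {t}) : G.Good S N P T := by
  classical
  obtain ⟨lo, hi, H, L, h⟩ := h
  -- Each `g t` is contracted onto `t`, whose interval becomes the one from the first start in `g t`
  -- to `L`.
  have hmin : ∀ t, ∃ x, t ∈ T → x ∈ g t ∧ ∀ y ∈ g t, lo x ≤ lo y := by
    intro t
    by_cases ht : t ∈ T
    · obtain ⟨x, hx, hx'⟩ := (Set.toFinite (g t)).exists_minimalFor lo _ ⟨t, (hg.2 t ht).2.1⟩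
      exact ⟨x, fun _ => ⟨hx, fun y hy => by
        rcases le_total (lo x) (lo y) with h | h
        · exact h
        · exact hx' hy h⟩⟩
    · exact ⟨t, fun h => absurd h ht⟩
  choose m hm using hmin
  have hmt : ∀ t ∈ T, lo (m t) ≤ lo t := fun t ht => (hm t ht).2 t (hg.2 t ht).2.1
  have hlo : ∀ v ∈ P, (if v ∈ T then lo (m v) else lo v) ≤ lo v := fun v hv => by
    split_ifs with hT
    · exact hmt v hT
    · exact le_rfl
  have hhi : ∀ v ∈ P, hi v ≤ if v ∈ T then L else hi v := fun v hv => by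
    split_ifs with hT
    · exact h.hi_le v (hPA hv)
    · exact le_rfl
  refine ⟨fun v => if v ∈ T then lo (m v) else lo v, fun v => if v ∈ T then L else hi v,
    H ∩ P ∪ T, L, ?_⟩
  constructor
  · exact Set.union_subset Set.inter_subset_right hTP
  · exact fun v hv hvS => Or.inl ⟨h.focus v (hPA hv) hvS, hv⟩
  · exact Set.subset_union_right
  · exact fun v hv => (hlo v hv).trans ((h.lo_le v (hPA hv)).trans (hhi v hv))
  · intro v hv
    split_ifs
    · exact le_rfl
    · exact h.hi_le v (hPA hv)
  · intro v hv hvH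
    simp only [Set.mem_union, not_or, Set.mem_inter_iff, not_and] at hvH
    simp only [hvH.2, if_false]
    exact h.single v (hPA hv) fun hH => hvH.1 hH hv
  · intro v hv
    simp [hv]
  · exact fun u hu v hv huv =>
      (hlo u hu).trans ((h.adj u (hPA hu) v (hPA hv) huv).trans (hhi v hv))
  · intro t
    -- The new focus vertices in bag `t` inject into the old ones: `v ∈ T` goes to an old focus
    -- vertex of `g v` in that bag, any other `v` to itself.
    have hrep : ∀ v, ∃ y, v ∈ H ∩ P ∪ T → (if v ∈ T then lo (m v) else lo v) ≤ t →
        (t ≤ if v ∈ T then L else hi v) → (y ∈ H ∧ lo y ≤ t ∧ t ≤ hi y) ∧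
          (v ∈ T → y ∈ g v) ∧ (v ∉ T → y = v) := by
      intro v
      by_cases hv : v ∈ T
      · by_cases hc : lo (m v) ≤ t ∧ t ≤ L
        · obtain ⟨z, hz, hzZ⟩ := (hg.2 v hv).2.2
          obtain ⟨y, hy, hy'⟩ := h.exists_mem_bag (hg.2 v hv).1 (hgA v hv).1 (hm v hv).1 hz hzZ
            hc.1 hc.2
          exact ⟨y, fun _ _ _ => ⟨hy', fun _ => hy, fun h => absurd hv h⟩⟩
        · refine ⟨v, fun _ h1 h2 => ?_⟩
          rw [if_pos hv] at h1 h2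
          exact absurd ⟨h1, h2⟩ hc
      · refine ⟨v, fun h1 h2 h3 => ⟨⟨?_, ?_, ?_⟩, fun h => absurd h hv, fun _ => rfl⟩⟩
        · exact (h1.resolve_right hv).1
        · rwa [if_neg hv] at h2
        · rwa [if_neg hv] at h3
    choose y hy using hrep
    refine (Set.ncard_le_ncard_of_injOn y ?_ ?_ (Set.toFinite _)).trans (h.card t)
    · rintro v ⟨h1, h2, h3⟩
      exact (hy v h1 h2 h3).1
    · rintro u ⟨h1, h2, h3⟩ v ⟨k1, k2, k3⟩ huv
      obtain ⟨-, hu, hu'⟩ := hy u h1 h2 h3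
      obtain ⟨-, hv, hv'⟩ := hy v k1 k2 k3
      have aux : ∀ a b : V, a ∈ T → b ∉ T → b ∈ H ∩ P ∪ T → y a ∈ g a → y b = b → y a = y b →
          a = b := by
        intro a b ha hb hbP hya hyb hab
        rw [hab, hyb] at hya
        exact ((hgA a ha).2 ⟨hya, (hbP.resolve_right hb).2⟩).symm
      by_cases huT : u ∈ T <;> by_cases hvT : v ∈ T
      · by_contra hne
        exact Set.disjoint_left.1 (hg.1 u huT v hvT hne) (hu huT) (huv ▸ hv hvT)
      · exact aux u v huT hvT k1 (hu huT) (hv' hvT) huv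
      · exact (aux v u hvT huT h1 (hv hvT) (hu' huT) huv.symm).symm
      · rw [← hu' huT, huv, hv' hvT]

/-- If `(A, Z)` is a good separation of minimum order among those beyond `P`, then every separation
between `P` and `A` has at least this order. -/
theorem Good.ncard_le_of_minimal [Finite V] {G : SimpleGraph V} {S : Set V} {N : ℕ}
    {A Z P : Set V} (h : G.Good S N A Z) (hA : G.IsSep A Z)
    (hmin : ∀ A' Z', G.IsSep A' Z' → G.Good S N A' Z' → P ⊆ A' → Z.ncard ≤ Z'.ncard)
    {P' T' : Set V} (hP' : G.IsSep P' T') (hPP : P ⊆ P') (hPA : P' ⊆ A) :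
    Z.ncard ≤ T'.ncard := by
  induction hn : T'.ncard using Nat.strong_induction_on generalizing P' T' with
  | _ n ih =>
  -- If nothing between `P'` and `A` has smaller order, then `T'` is linked to `Z`. So `(P', T')`
  -- inherits goodness from `A`, and `hmin` applies to it.
  by_cases hsm : ∃ P₁ T₁, G.IsSep P₁ T₁ ∧ P' ⊆ P₁ ∧ P₁ ⊆ A ∧ T₁.ncard < n
  · obtain ⟨P₁, T₁, h1, h2, h3, h4⟩ := hsm
    exact (ih _ h4 h1 (hPP.trans h2) h3 rfl).trans h4.le
  · push Not at hsm
    obtain ⟨g, hg, hgA⟩ := exists_linkage_of_minimal hP' hPA hA.2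
      (fun P₁ T₁ h1 h2 h3 _ _ => hn ▸ hsm P₁ T₁ h1 h2 h3)
    exact hn ▸ hmin _ _ hP' (h.restrict hPA hP'.1 hg hgA) hPP

/-! ### Growing a rooted model of a tree -/

/-- In a forest, a vertex outside a connected set has at most one neighbour in it. -/
theorem IsAcyclic.eq_of_adj_connSet {F : SimpleGraph W} (hF : F.IsAcyclic) {T : Set W}
    (hT : F.ConnSet T) {w a b : W} (hw : w ∉ T) (ha : a ∈ T) (hb : b ∈ T) (hwa : F.Adj w a)
    (hwb : F.Adj w b) : a = b := by
  by_contra hab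
  refine isBridge_iff.1 (isAcyclic_iff_forall_adj_isBridge.1 hF hwa) ?_
  have h1 : (F.deleteEdges {s(w, a)}).Reachable a b := by
    refine hT a ha {x | (F.deleteEdges {s(w, a)}).Reachable a x} (Reachable.refl _) ?_ hb
    intro x hx hxT y hyT hxy
    refine Reachable.trans hx (Adj.reachable ?_)
    rw [deleteEdges_adj]
    refine ⟨hxy, fun h => ?_⟩
    rw [Set.mem_singleton_iff, Sym2.eq_iff] at h
    rcases h with h | h
    · exact hw (h.1 ▸ hxT)
    · exact hw (h.2 ▸ hyT)
  refine Reachable.trans (Adj.reachable ?_) h1.symm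
  rw [deleteEdges_adj]
  refine ⟨hwb, fun h => ?_⟩
  rw [Set.mem_singleton_iff, Sym2.eq_iff] at h
  rcases h with h | h
  · exact hab h.2.symm
  · exact hw (h.1 ▸ ha)

/-- A model of `F[T]` inside `G[A]` with a chosen vertex `z w` in every branch set `B w`. -/
structure PartialModel (F : SimpleGraph W) (G : SimpleGraph V) (T : Set W) (A : Set V) (z : W → V)
    (B : W → Set V) : Prop where
  connSet : ∀ w ∈ T, G.ConnSet (B w)
  mem : ∀ w ∈ T, z w ∈ B w
  subset : ∀ w ∈ T, B w ⊆ A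
  disjoint : ∀ w ∈ T, ∀ w' ∈ T, w ≠ w' → Disjoint (B w) (B w')
  adj : ∀ w ∈ T, ∀ w' ∈ T, F.Adj w w' → ∃ u ∈ B w, ∃ v ∈ B w', G.Adj u v

theorem PartialModel.injOn {F : SimpleGraph W} {G : SimpleGraph V} {T : Set W} {A : Set V}
    {z : W → V} {B : W → Set V} (h : PartialModel F G T A z B) : Set.InjOn z T := by
  intro w hw w' hw' hz
  by_contra hne
  exact Set.disjoint_left.1 (h.disjoint w hw w' hw' hne) (h.mem w hw) (hz ▸ h.mem w' hw')

/-- Extending the branch sets of a partial model along a linkage. -/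
theorem PartialModel.extend {F : SimpleGraph W} {G : SimpleGraph V} {T : Set W} {A A' Y : Set V}
    {z : W → V} {B : W → Set V} (h : PartialModel F G T A z B) (hA : A ⊆ A') {g : V → Set V}
    (hg : G.IsLinkage (z '' T) Y g) (hgA : ∀ t ∈ z '' T, g t ⊆ A' ∧ g t ∩ A ⊆ {t}) :
    ∃ z', (∀ w ∈ T, z' w ∈ Y) ∧ PartialModel F G T A' z' fun w => B w ∪ g (z w) := by
  have hz : ∀ w ∈ T, z w ∈ z '' T := fun w hw => Set.mem_image_of_mem z hw
  have hex : ∀ w, ∃ x, w ∈ T → x ∈ g (z w) ∧ x ∈ Y := fun w => by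
    by_cases hw : w ∈ T
    · obtain ⟨x, hx⟩ := (hg.2 (z w) (hz w hw)).2.2
      exact ⟨x, fun _ => hx⟩
    · exact ⟨z w, fun h => absurd h hw⟩
  choose z' hz' using hex
  have hBg : ∀ w ∈ T, ∀ w' ∈ T, w ≠ w' → Disjoint (B w) (g (z w')) := by
    intro w hw w' hw' hne
    rw [Set.disjoint_left]
    intro v hv hv'
    obtain rfl : v = z w' := (hgA _ (hz w' hw')).2 ⟨hv', h.subset w hw hv⟩
    exact Set.disjoint_left.1 (h.disjoint w hw w' hw' hne) hv (h.mem w' hw')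
  refine ⟨z', fun w hw => (hz' w hw).2, fun w hw => ?_, fun w hw => Or.inr (hz' w hw).1,
    fun w hw => ?_, fun w hw w' hw' hne => ?_, fun w hw w' hw' hadj => ?_⟩
  · exact (h.connSet w hw).union (hg.2 _ (hz w hw)).1 (h.mem w hw) (hg.2 _ (hz w hw)).2.1
  · exact Set.union_subset ((h.subset w hw).trans hA) (hgA _ (hz w hw)).1
  · rw [Set.disjoint_union_left, Set.disjoint_union_right, Set.disjoint_union_right]
    exact ⟨⟨h.disjoint w hw w' hw' hne, hBg w hw w' hw' hne⟩, (hBg w' hw' w hw hne.symm).symm,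
      hg.1 _ (hz w hw) _ (hz w' hw') fun he => hne (h.injOn hw hw' he)⟩
  · obtain ⟨u, hu, v, hv, huv⟩ := h.adj w hw w' hw' hadj
    exact ⟨u, Or.inl hu, v, Or.inl hv, huv⟩

/-- A partial model for which `A` is good, and no good separation beyond `A` has smaller order. -/
def TightModel (F : SimpleGraph W) (G : SimpleGraph V) (S : Set V) (N : ℕ) (T : Set W)
    (A : Set V) : Prop :=
  F.ConnSet T ∧ ∃ z B, PartialModel F G T A z B ∧ G.IsSep A (z '' T) ∧ G.Good S N A (z '' T) ∧
    ∀ A' Z', G.IsSep A' Z' → G.Good S N A' Z' → A ⊆ A' → T.ncard ≤ Z'.ncard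

/-- A partial model extends to any good separation beyond it that has the same order and has minimum
order among all good separations beyond. -/
theorem PartialModel.tightModel [Finite V] {F : SimpleGraph W} {G : SimpleGraph V} {S : Set V}
    {N : ℕ} {T : Set W} {A A' Z' : Set V} {z : W → V} {B : W → Set V}
    (h : PartialModel F G T A z B) (hT : F.ConnSet T) (hA : G.IsSep A (z '' T))
    (hA' : G.IsSep A' Z') (hgood : G.Good S N A' Z') (hAA : A ⊆ A') (hcard : Z'.ncard = T.ncard)
    (hmin : ∀ P Q, G.IsSep P Q → G.Good S N P Q → A ⊆ P → Z'.ncard ≤ Q.ncard) :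
    TightModel F G S N T A' := by
  have hzc : (z '' T).ncard = T.ncard := h.injOn.ncard_image
  obtain ⟨g, hg, hgA⟩ := exists_linkage_of_minimal hA hAA hA'.2 fun P Q h1 h2 h3 _ _ => by
    rw [hzc, ← hcard]
    exact hgood.ncard_le_of_minimal hA' hmin h1 h2 h3
  obtain ⟨z', hz', h'⟩ := h.extend hAA hg hgA
  have himg : z' '' T = Z' := by
    refine Set.eq_of_subset_of_ncard_le ?_ ?_ (Set.toFinite _)
    · rintro _ ⟨w, hw, rfl⟩
      exact hz' w hw
    · rw [h'.injOn.ncard_image, hcard]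
  refine ⟨hT, z', _, h', himg ▸ hA', himg ▸ hgood, fun P Q h1 h2 h3 => ?_⟩
  rw [← hcard]
  exact hmin P Q h1 h2 (hAA.trans h3)

theorem exists_minimal_good [Finite V] {G : SimpleGraph V} {S : Set V} {N : ℕ} {P T : Set V}
    (hP : G.IsSep P T) (hgood : G.Good S N P T) :
    ∃ A Z, G.IsSep A Z ∧ G.Good S N A Z ∧ P ⊆ A ∧ Z.ncard ≤ T.ncard ∧
      ∀ A' Z', G.IsSep A' Z' → G.Good S N A' Z' → P ⊆ A' → Z.ncard ≤ Z'.ncard := by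
  classical
  have hex : ∃ n, ∃ A Z, G.IsSep A Z ∧ G.Good S N A Z ∧ P ⊆ A ∧ Z.ncard = n :=
    ⟨_, P, T, hP, hgood, subset_rfl, rfl⟩
  obtain ⟨A, Z, h1, h2, h3, h4⟩ := Nat.find_spec hex
  refine ⟨A, Z, h1, h2, h3, h4 ▸ Nat.find_min' hex ⟨P, T, hP, hgood, subset_rfl, rfl⟩,
    fun A' Z' h1' h2' h3' => h4 ▸ Nat.find_min' hex ⟨A', Z', h1', h2', h3', rfl⟩⟩

/-- A vertex of the tree `F` by which `T` can be extended, and a vertex of `G` to represent it. -/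
theorem exists_extension [Finite W] {F : SimpleGraph W} {G : SimpleGraph V} {S : Set V} {N : ℕ}
    (hF : F.IsTree) {T : Set W} {A : Set V} {z : W → V} {B : W → Set V} (hT : F.ConnSet T)
    (hTu : T ≠ Set.univ) (hAu : A ≠ Set.univ) (h : PartialModel F G T A z B)
    (hA : G.IsSep A (z '' T)) (hgood : G.Good S N A (z '' T))
    (hmin : ∀ A' Z', G.IsSep A' Z' → G.Good S N A' Z' → A ⊆ A' → T.ncard ≤ Z'.ncard) :
    ∃ w ∉ T, ∃ v ∉ A, F.ConnSet (insert w T) ∧ ∀ w' ∈ T, F.Adj w' w → G.Adj (z w') v := by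
  rcases T.eq_empty_or_nonempty with rfl | ⟨w₁, hw₁⟩
  · obtain ⟨w⟩ := hF.connected.nonempty
    obtain ⟨v, hv⟩ := (Set.ne_univ_iff_exists_notMem A).1 hAu
    refine ⟨w, by simp, v, hv, ?_, by simp⟩
    rw [insert_empty_eq]
    exact connSet_singleton F w
  · have hex : ∃ w₀ ∈ T, ∃ w ∉ T, F.Adj w₀ w := by
      by_contra! hno
      exact hTu (Set.univ_subset_iff.1 (connSet_univ hF.connected.preconnected w₁ trivial T hw₁
        fun a ha _ b _ hab => by_contra fun hb => hno a ha b hb hab))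
    obtain ⟨w₀, hw₀, w, hw, hadj⟩ := hex
    -- Otherwise `z w₀` could be dropped from the boundary, giving a good separation of smaller
    -- order.
    have hv : ∃ v ∉ A, G.Adj (z w₀) v := by
      by_contra! hno
      have h1 : G.IsSep A (z '' T \ {z w₀}) := by
        refine ⟨Set.sdiff_subset.trans hA.1, fun u hu hu' v huv => ?_⟩
        by_cases hz : u = z w₀
        · by_contra hvA
          exact hno v hvA (hz ▸ huv)
        · exact hA.2 u hu (fun hmem => hu' ⟨hmem, hz⟩) v huv
      have h2 := hmin _ _ h1 (hgood.subset_boundary Set.sdiff_subset) subset_rfl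
      have h3 := Set.ncard_sdiff_singleton_lt_of_mem (Set.mem_image_of_mem z hw₀)
        ((Set.toFinite T).image z)
      rw [h.injOn.ncard_image] at h3
      omega
    obtain ⟨v, hvA, hv⟩ := hv
    refine ⟨w, hw, v, hvA, ?_, fun w' hw' hadj' => ?_⟩
    · rw [← Set.union_singleton]
      exact hT.union_of_adj (connSet_singleton F w) hw₀ rfl (Or.inr hadj)
    -- Here the tree matters: `w₀` is the only neighbour of `w` in `T`, so one edge from `z w₀` to
    -- `v` suffices.
    · obtain rfl := hF.isAcyclic.eq_of_adj_connSet hT hw hw' hw₀ hadj'.symm hadj.symm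
      exact hv

theorem PartialModel.insert {F : SimpleGraph W} {G : SimpleGraph V} {T : Set W} {A : Set V}
    {z : W → V} {B : W → Set V} (h : PartialModel F G T A z B) {w : W} (hw : w ∉ T) {v : V}
    (hv : v ∉ A) (hadj : ∀ w' ∈ T, F.Adj w' w → G.Adj (z w') v) :
    ∃ z' B', z' '' (insert w T) = insert v (z '' T) ∧
      PartialModel F G (insert w T) (insert v A) z' B' := by
  classical
  have hne : ∀ w' ∈ T, w' ≠ w := fun w' hw' he => hw (he ▸ hw')
  have hvB : ∀ w' ∈ T, v ∉ B w' := fun w' hw' hvB => hv (h.subset w' hw' hvB)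
  refine ⟨Function.update z w v, Function.update B w {v}, ?_, ?_⟩
  · rw [Set.image_insert_eq, Function.update_self]
    congr 1
    exact Set.image_congr fun w' hw' => Function.update_of_ne (hne w' hw') _ _
  · constructor
    · rintro w' (rfl | hw')
      · rw [Function.update_self]; exact connSet_singleton G v
      · rw [Function.update_of_ne (hne w' hw')]; exact h.connSet w' hw'
    · rintro w' (rfl | hw')
      · simp
      · rw [Function.update_of_ne (hne w' hw'), Function.update_of_ne (hne w' hw')]
        exact h.mem w' hw'
    · rintro w' (rfl | hw')
      · simp
      · rw [Function.update_of_ne (hne w' hw')]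
        exact (h.subset w' hw').trans (Set.subset_insert _ _)
    · rintro w₁ (rfl | hw₁) w₂ (rfl | hw₂) h12
      · exact absurd rfl h12
      · rw [Function.update_self, Function.update_of_ne (hne w₂ hw₂)]
        simpa using hvB w₂ hw₂
      · rw [Function.update_self, Function.update_of_ne (hne w₁ hw₁)]
        simpa using hvB w₁ hw₁
      · rw [Function.update_of_ne (hne w₁ hw₁), Function.update_of_ne (hne w₂ hw₂)]
        exact h.disjoint w₁ hw₁ w₂ hw₂ h12
    · rintro w₁ (rfl | hw₁) w₂ (rfl | hw₂) h12
      · exact absurd h12 (F.irrefl)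
      · rw [Function.update_self, Function.update_of_ne (hne w₂ hw₂)]
        exact ⟨v, rfl, z w₂, h.mem w₂ hw₂, (hadj w₂ hw₂ h12.symm).symm⟩
      · rw [Function.update_self, Function.update_of_ne (hne w₁ hw₁)]
        exact ⟨z w₁, h.mem w₁ hw₁, v, rfl, hadj w₁ hw₁ h12⟩
      · rw [Function.update_of_ne (hne w₁ hw₁), Function.update_of_ne (hne w₂ hw₂)]
        exact h.adj w₁ hw₁ w₂ hw₂ h12

/-- A tight model of a proper part of the tree `F` can be enlarged. -/
theorem TightModel.exists_larger [Finite V] [Finite W] {F : SimpleGraph W} {G : SimpleGraph V}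
    {S : Set V} {N : ℕ} (hF : F.IsTree) (hN : Nat.card W ≤ N) {T : Set W} {A : Set V}
    (h : TightModel F G S N T A) (hTu : T ≠ Set.univ) (hAu : A ≠ Set.univ) :
    ∃ T' A', TightModel F G S N T' A' ∧ A.ncard < A'.ncard := by
  obtain ⟨hT, z, B, hB, hA, hgood, hmin⟩ := h
  obtain ⟨w, hw, v, hv, hT', hadj⟩ := exists_extension hF hT hTu hAu hB hA hgood hmin
  obtain ⟨z', B', hz', hB'⟩ := hB.insert hw hv hadj
  have hTc : (insert w T).ncard = T.ncard + 1 := Set.ncard_insert_of_notMem hw (Set.toFinite _)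
  have hzc : (z '' T).ncard = T.ncard := hB.injOn.ncard_image
  have hZc : (insert v (z '' T)).ncard = T.ncard + 1 := by
    rw [Set.ncard_insert_of_notMem (fun h => hv (hA.1 h)) (Set.toFinite _), hzc]
  have hTN : T.ncard + 1 ≤ N := hTc ▸ (Set.ncard_le_card _).trans hN
  have hsep : G.IsSep (insert v A) (insert v (z '' T)) := by
    refine ⟨Set.insert_subset_insert hA.1, ?_⟩
    rintro u (rfl | hu) hu' x hux
    · exact absurd (Set.mem_insert _ _) hu'
    · exact Or.inr (hA.2 u hu (fun h => hu' (Or.inr h)) x hux)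
  have hgood' : G.Good S N (insert v A) (insert v (z '' T)) := by
    refine hgood.append hA (Set.subset_insert _ _) hsep.1 ?_ ?_ ?_
    · rintro x ⟨rfl | hx, hxA⟩
      · exact absurd hxA hv
      · exact hx
    · rintro x ⟨-, rfl | hx, hxA⟩
      · exact Set.mem_insert _ _
      · exact absurd hx hxA
    · rw [Set.union_eq_self_of_subset_left (Set.subset_insert _ _), hZc]
      exact hTN
  obtain ⟨A', Z', h1, h2, h3, h4, h5⟩ := exists_minimal_good hsep hgood'
  have hAA : A ⊆ A' := (Set.subset_insert _ _).trans h3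
  have hlt : A.ncard < A'.ncard := by
    refine Set.ncard_lt_ncard ⟨hAA, fun h => hv (h (h3 (Set.mem_insert _ _)))⟩ (Set.toFinite _)
  have h6 := hmin _ _ h1 h2 hAA
  -- The order of `Z'` is `|T|` or `|T| + 1`. In the larger case the model of `T` with `w` extends
  -- to `A'`; otherwise the old model does.
  rcases Nat.lt_or_ge T.ncard Z'.ncard with h7 | h7
  · refine ⟨insert w T, A', ?_, hlt⟩
    exact hB'.tightModel hT' (hz' ▸ hsep) h1 h2 h3 (by omega) h5
  · refine ⟨T, A', ?_, hlt⟩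
    refine hB.tightModel hT hA h1 h2 hAA (by omega) fun P Q k1 k2 k3 => ?_
    have := hmin P Q k1 k2 k3
    omega

/-- A tight model of the whole of `F` extends to a model all of whose branch sets meet `S`. -/
theorem TightModel.exists_rooted [Finite V] [Finite W] [Nonempty W] {F : SimpleGraph W}
    {G : SimpleGraph V} {S A : Set V} {N : ℕ} (hN : 2 * Nat.card W ≤ N + 1)
    (h : TightModel F G S N Set.univ A) :
    ∃ B : W → Set V, (∀ w, G.ConnSet (B w) ∧ (B w ∩ S).Nonempty) ∧
      (∀ w w', w ≠ w' → Disjoint (B w) (B w')) ∧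
      ∀ w w', F.Adj w w' → ∃ u ∈ B w, ∃ v ∈ B w', G.Adj u v := by
  obtain ⟨-, z, B, hB, hA, hgood, hmin⟩ := h
  have hzc : (z '' Set.univ).ncard = Nat.card W := by
    rw [hB.injOn.ncard_image, Set.ncard_univ]
  obtain ⟨g, hg, hgA⟩ := exists_linkage_of_minimal (A := Set.univ) (Y := S) hA
    (Set.subset_univ _) (fun _ _ _ _ _ => trivial) fun P Q h1 h2 _ h4 h5 => by
      by_contra! hlt
      rw [hzc] at hlt
      -- Appending `Q` to the boundary of `A` makes a bag with at most `|F| + (|F| - 1)` relevant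
      -- vertices. This is the source of `2|F| - 1`.
      have hgood' : G.Good S N P Q := by
        refine hgood.append hA h2 h1.1 h4 h5 ((Set.ncard_union_le _ _).trans ?_)
        rw [hzc]
        omega
      have := hmin _ _ h1 hgood' h2
      rw [Set.ncard_univ] at this
      omega
  obtain ⟨z', hz', h'⟩ := hB.extend (Set.subset_univ _) hg hgA
  exact ⟨_, fun w => ⟨h'.connSet w trivial, ⟨z' w, h'.mem w trivial, hz' w trivial⟩⟩,
    fun w w' => h'.disjoint w trivial w' trivial, fun w w' => h'.adj w trivial w' trivial⟩

/-- A graph without a model of the tree `F` in which all branch sets meet `S` has a path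
decomposition focused on `S` with at most `2 |F| - 1` relevant vertices in each bag. -/
theorem good_univ_of_not_rooted [Finite V] [Finite W] {F : SimpleGraph W}
    {G : SimpleGraph V} {S : Set V} {N : ℕ} (hF : F.IsTree) (hN : 2 * Nat.card W ≤ N + 1)
    (hno : ¬ ∃ B : W → Set V, (∀ w, G.ConnSet (B w) ∧ (B w ∩ S).Nonempty) ∧
      (∀ w w', w ≠ w' → Disjoint (B w) (B w')) ∧
      ∀ w w', F.Adj w w' → ∃ u ∈ B w, ∃ v ∈ B w', G.Adj u v) :
    G.Good S N Set.univ ∅ := by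
  have : Nonempty W := hF.connected.nonempty
  have hN' : Nat.card W ≤ N := by
    have : 0 < Nat.card W := Nat.card_pos
    omega
  -- Induction on the number of vertices outside `A`, started below from the empty model.
  have key : ∀ k, ∀ T A, TightModel F G S N T A → Nat.card V - A.ncard = k →
      G.Good S N Set.univ ∅ := by
    intro k
    induction k using Nat.strong_induction_on with
    | _ k ih =>
    intro T A h hk
    by_cases hTu : T = Set.univ
    · exact absurd (TightModel.exists_rooted hN (hTu ▸ h)) hno
    by_cases hAu : A = Set.univ
    · subst hAu
      obtain ⟨-, z, B, -, -, hgood, -⟩ := h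
      exact hgood.subset_boundary (Set.empty_subset _)
    · obtain ⟨T', A', h', hlt⟩ := h.exists_larger hF hN' hTu hAu
      have := Set.ncard_le_card A'
      exact ih _ (by omega) T' A' h' rfl
  rcases isEmpty_or_nonempty V with hV | ⟨⟨v⟩⟩
  · rw [Set.univ_eq_empty_iff.2 hV]
    exact good_empty G S N
  refine key _ ∅ ∅ ⟨connSet_empty F, fun _ => v, fun _ => ∅, ⟨?_, ?_, ?_, ?_, ?_⟩, ?_, ?_, ?_⟩ rfl
  all_goals simp [IsSep, good_empty]

/-! ### Components off the focus and layered decompositions -/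

theorem Reachable.mem_of_closed {G : SimpleGraph V} {a b : V} (h : G.Reachable a b) {t : Set V}
    (ha : a ∈ t) (ht : ∀ x ∈ t, ∀ y, G.Adj x y → y ∈ t) : b ∈ t := by
  obtain ⟨p⟩ := h
  induction p with
  | nil => exact ha
  | cons hab _ ih => exact ih (ht _ ha _ hab)

theorem connSet_of_reachable_inside {G : SimpleGraph V} {s : Set V} {r : V}
    (h : ∀ w ∈ s, (G.inside s).Reachable r w) : G.ConnSet s := by
  intro u hu t hut ht w hw
  exact ((h u hu).symm.trans (h w hw)).mem_of_closed hut
    fun x hx y hxy => ht x hx hxy.2.1 y hxy.2.2 hxy.1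

/-- The vertices of `A` with a neighbour outside `A`. -/
def innerBoundary (G : SimpleGraph V) (A : Set V) : Set V :=
  {v | v ∈ A ∧ ∃ u ∉ A, G.Adj u v}

/-- A path decomposition of `G[C]`, given by intervals, together with a layering with layers
`1, 2, …` such that the boundary of `C` lies in the first layer and every bag meets every layer in
at most `N` vertices. -/
structure IsLayered (G : SimpleGraph V) (N : ℕ) (C : Set V) (lo hi layer : V → ℕ) : Prop where
  lo_le : ∀ v ∈ C, lo v ≤ hi v
  pos : ∀ v ∈ C, 1 ≤ layer v
  adj : ∀ u ∈ C, ∀ v ∈ C, G.Adj u v → lo u ≤ hi v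
  layer_adj : ∀ u ∈ C, ∀ v ∈ C, G.Adj u v → layer u ≤ layer v + 1
  boundary : ∀ v ∈ G.innerBoundary C, layer v = 1
  card : ∀ t k, {v | v ∈ C ∧ layer v = k ∧ lo v ≤ t ∧ t ≤ hi v}.ncard ≤ N

/-- The vertex set of the component of `G[A]` that contains `v`. -/
def compSet (G : SimpleGraph V) (A : Set V) (v : V) : Set V :=
  {w | (G.inside A).Reachable v w}

theorem mem_compSet (G : SimpleGraph V) (A : Set V) (v : V) : v ∈ G.compSet A v :=
  Reachable.refl _

theorem compSet_subset {G : SimpleGraph V} {A : Set V} {v : V} (hv : v ∈ A) :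
    G.compSet A v ⊆ A :=
  fun _ hw => Reachable.mem_of_closed hw hv fun _ _ _ hxy => hxy.2.2

theorem compSet_closed {G : SimpleGraph V} {A : Set V} {v x y : V} (hx : x ∈ G.compSet A v)
    (hxA : x ∈ A) (hyA : y ∈ A) (hxy : G.Adj x y) : y ∈ G.compSet A v :=
  Reachable.trans hx (Adj.reachable ⟨hxy, hxA, hyA⟩)

theorem compSet_eq {G : SimpleGraph V} {A : Set V} {v x : V} (hx : x ∈ G.compSet A v) :
    G.compSet A x = G.compSet A v :=
  Set.ext fun _ => ⟨fun h => Reachable.trans hx h, fun h => Reachable.trans (Reachable.symm hx) h⟩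

/-- Off the focus every interval is a single point and adjacent intervals meet, so a whole component
of `A \ H` lies in one bag. -/
theorem IsFocused.lo_eq_of_mem_compSet {G : SimpleGraph V} {S : Set V} {N : ℕ} {A Z : Set V}
    {lo hi : V → ℕ} {H : Set V} {L : ℕ} (h : G.IsFocused S N A Z lo hi H L) {v w : V}
    (hw : w ∈ G.compSet (A \ H) v) : lo w = lo v := by
  refine Reachable.mem_of_closed (t := {x | lo x = lo v}) hw rfl ?_
  rintro x hx y ⟨hxy, hxA, hyA⟩
  have h1 := h.adj x hxA.1 y hyA.1 hxy
  have h2 := h.adj y hyA.1 x hxA.1 hxy.symm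
  have h3 := h.single x hxA.1 hxA.2
  have h4 := h.single y hyA.1 hyA.2
  simp only [Set.mem_ofPred_eq] at hx ⊢
  omega

/-- For a focus `H` of minimum size, the complement of every component of `C \ H` is connected. -/
theorem IsFocused.connSet_compl_compSet [Finite V] {G : SimpleGraph V} {N : ℕ} {C : Set V}
    {lo hi : V → ℕ} {H : Set V} {L : ℕ} (hG : G.Preconnected) (hC : G.ConnSet Cᶜ)
    (hCne : Cᶜ.Nonempty) (h : G.IsFocused (G.innerBoundary C) N C ∅ lo hi H L)
    (hmin : ∀ lo' hi' H' L', G.IsFocused (G.innerBoundary C) N C ∅ lo' hi' H' L' →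
      H.ncard ≤ H'.ncard) {v : V} (hv : v ∈ C \ H) : G.ConnSet (G.compSet (C \ H) v)ᶜ := by
  classical
  obtain ⟨r, hr⟩ := hCne
  set D := G.compSet (C \ H) v with hD
  have hDsub : D ⊆ C \ H := compSet_subset hv
  -- `K` is the part of the complement of `D` that `D` cuts off from `r`. It lies in `C`, and its
  -- only outside neighbours are in `D`.
  set K : Set V := {w | w ∉ D ∧ ¬ (G.inside Dᶜ).Reachable r w} with hK
  have hRK : ∀ w, w ∉ C → w ∉ K := by
    intro w hw hwK
    refine hwK.2 (hC r hr {x | (G.inside Dᶜ).Reachable r x} (Reachable.refl _) ?_ hw)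
    intro a ha haC b hbC hab
    exact Reachable.trans ha
      (Adj.reachable ⟨hab, fun h => haC (hDsub h).1, fun h => hbC (hDsub h).1⟩)
  have hKadj : ∀ a ∈ K, ∀ b, G.Adj a b → b ∈ K ∨ b ∈ D := by
    intro a ha b hab
    by_contra! hb
    have h1 : (G.inside Dᶜ).Reachable r b := by
      by_contra hb'
      exact hb.1 ⟨hb.2, hb'⟩
    exact ha.2 (h1.trans (Adj.reachable ⟨hab.symm, hb.2, ha.1⟩))
  by_cases hKe : K = ∅
  · refine connSet_of_reachable_inside (r := r) fun w hw => ?_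
    by_contra hno
    exact Set.eq_empty_iff_forall_notMem.1 hKe w ⟨hw, hno⟩
  exfalso
  obtain ⟨x, hx⟩ := Set.nonempty_iff_ne_empty.2 hKe
  by_cases hKH : ∃ y ∈ K, y ∈ H
  · obtain ⟨y, hyK, hyH⟩ := hKH
    have hDt : ∀ u ∈ D, lo u = lo v ∧ hi u = lo v := fun u hu => by
      have h1 := h.lo_eq_of_mem_compSet hu
      have h2 := h.single u (hDsub hu).1 (hDsub hu).2
      omega
    have hKD : ∀ u, u ∈ K → u ∉ D := fun u hu => hu.1
    -- Moving all of `K` into the bag of `D` removes `K ∩ H` from the focus, against minimality.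
    have key := hmin (fun u => if u ∈ K then lo v else lo u) (fun u => if u ∈ K then lo v else hi u)
      (H \ K) L ?_
    · exact absurd key (not_le.2 (Set.ncard_lt_ncard
        ⟨Set.sdiff_subset, fun hs => (hs hyH).2 hyK⟩ (Set.toFinite _)))
    constructor
    · exact Set.sdiff_subset.trans h.subset
    · intro u hu huS
      have huH := h.focus u hu huS
      refine ⟨huH, fun huK => ?_⟩
      obtain ⟨-, w, hw, hwu⟩ := huS
      rcases hKadj u huK w hwu.symm with h1 | h1
      · exact hRK w hw h1
      · exact hw (hDsub h1).1
    · exact Set.empty_subset _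
    · intro u hu
      split_ifs
      · exact le_rfl
      · exact h.lo_le u hu
    · intro u hu
      split_ifs
      · exact (h.lo_le v hv.1).trans (h.hi_le v hv.1)
      · exact h.hi_le u hu
    · intro u hu huH
      split_ifs with huK
      · rfl
      · exact h.single u hu fun hH => huH ⟨hH, huK⟩
    · exact fun u hu => absurd hu (Set.notMem_empty u)
    · intro a ha b hb hab
      split_ifs with haK hbK hbK
      · exact le_rfl
      · exact ((hDt b ((hKadj a haK b hab).resolve_left hbK)).2).ge
      · exact ((hDt a ((hKadj b hbK a hab.symm).resolve_left haK)).1).le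
      · exact h.adj a ha b hb hab
    · intro t
      refine (Set.ncard_le_ncard ?_ (Set.toFinite _)).trans (h.card t)
      rintro u ⟨⟨huH, huK⟩, h1, h2⟩
      rw [if_neg huK] at h1 h2
      exact ⟨huH, h1, h2⟩
  · push Not at hKH
    -- If `K` misses `H`, a neighbour of `D` in `K` would belong to `D`. So `K` is closed under
    -- adjacency and contains `r`, a contradiction.
    refine hRK r hr ((hG x r).mem_of_closed hx fun a ha b hab => ?_)
    refine (hKadj a ha b hab).resolve_right fun hb => ha.1 ?_
    have haC : a ∈ C := by
      by_contra haC
      exact hRK a haC ha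
    exact compSet_closed hb (hDsub hb) ⟨haC, hKH a ha⟩ hab.symm

/-- Decodes a refined time into its block and its position there; applied twice, for old bag,
component and inner time. -/
theorem div_mod_of_mem_block {M t a b τ : ℕ} (hb : b < M) (h1 : t * M + a ≤ τ)
    (h2 : τ ≤ t * M + b) : τ / M = t ∧ a ≤ τ % M ∧ τ % M ≤ b := by
  have h3 : τ / M = t := by
    refine Nat.div_eq_of_lt_le (by omega) ?_
    rw [Nat.succ_mul]
    omega
  have h4 := Nat.div_add_mod' τ M
  rw [h3] at h4
  omega

/-- Layered path decompositions of the components of `C \ H` can be inserted into a path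
decomposition of `G[C]` that is focused on `H`. -/
theorem IsFocused.exists_isLayered [Finite V] {G : SimpleGraph V} {N : ℕ} {C : Set V}
    {lo hi : V → ℕ} {H : Set V} {L : ℕ} (h : G.IsFocused (G.innerBoundary C) N C ∅ lo hi H L)
    (hcomp : ∀ v ∈ C \ H, ∃ lo' hi' layer, G.IsLayered N (G.compSet (C \ H) v) lo' hi' layer) :
    ∃ lo' hi' layer, G.IsLayered N C lo' hi' layer := by
  classical
  rcases isEmpty_or_nonempty V with hV | ⟨⟨v₁⟩⟩
  · exact ⟨lo, hi, lo, by constructor <;> simp [Set.eq_empty_of_isEmpty]⟩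
  have hcomp' : ∀ D : Set V, ∃ lo' hi' layer : V → ℕ, ∀ v ∈ C \ H, D = G.compSet (C \ H) v →
      G.IsLayered N D lo' hi' layer := by
    intro D
    by_cases hD : ∃ v ∈ C \ H, D = G.compSet (C \ H) v
    · obtain ⟨v, hv, rfl⟩ := hD
      obtain ⟨lo', hi', layer, h'⟩ := hcomp v hv
      exact ⟨lo', hi', layer, fun _ _ _ => h'⟩
    · exact ⟨lo, lo, lo, fun v hv hDv => absurd ⟨v, hv, hDv⟩ hD⟩
  choose dlo dhi dla hd using hcomp'
  set comp := G.compSet (C \ H) with hcompdef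
  obtain ⟨B, hB⟩ := (Set.finite_range fun p : Set V × V => dhi p.1 p.2).bddAbove
  have hBK : ∀ D v, dhi D v < B + 1 := fun D v => Nat.lt_succ_of_le (hB ⟨(D, v), rfl⟩)
  obtain ⟨m, ⟨e⟩⟩ := Finite.exists_equiv_fin (Set V)
  set K := B + 1 with hKdef
  set M := m * K with hM
  set c : Set V → ℕ := fun D => (e D : ℕ) with hc
  have hcM : ∀ D v, c D * K + dhi D v < M := by
    intro D v
    have h1 : c D + 1 ≤ m := (e D).2
    have h2 := hBK D v
    have h3 := Nat.mul_le_mul_right K h1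
    rw [Nat.add_mul, one_mul] at h3
    omega
  have hMpos : 0 < M := lt_of_le_of_lt (Nat.zero_le _) (hcM ∅ v₁)
  have hcinj : ∀ D D', c D = c D' → D = D' := fun D D' hDD => e.injective (Fin.ext hDD)
  have hD : ∀ v ∈ C, v ∉ H → G.IsLayered N (comp v) (dlo (comp v)) (dhi (comp v)) (dla (comp v)) :=
    fun v hv hvH => hd _ v ⟨hv, hvH⟩ rfl
  have hmem : ∀ v, v ∈ comp v := fun v => mem_compSet G _ v
  have hsame : ∀ u ∈ C, u ∉ H → ∀ v ∈ C, v ∉ H → G.Adj u v → comp v = comp u :=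
    fun u hu huH v hv hvH huv =>
      compSet_eq (compSet_closed (hmem u) ⟨hu, huH⟩ ⟨hv, hvH⟩ huv)
  have hdlt : ∀ v ∈ C, v ∉ H → c (comp v) * K + dlo (comp v) v < M := fun v hv hvH =>
    lt_of_le_of_lt (Nat.add_le_add_left ((hD v hv hvH).lo_le v (hmem v)) _) (hcM (comp v) v)
  -- Every old bag becomes a block of `M = m * K` bags, in which component `D` owns slot `c D` of
  -- length `K`. Vertices of `H` fill whole blocks.
  refine ⟨fun v => if v ∈ H then lo v * M else lo v * M + (c (comp v) * K + dlo (comp v) v),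
    fun v => if v ∈ H then hi v * M + (M - 1) else lo v * M + (c (comp v) * K + dhi (comp v) v),
    fun v => if v ∈ H then 1 else dla (comp v) v + 1, ?_⟩
  constructor
  · intro v hv
    split_ifs with hvH
    · exact (Nat.mul_le_mul_right M (h.lo_le v hv)).trans (Nat.le_add_right _ _)
    · have := (hD v hv hvH).lo_le v (hmem v)
      omega
  · intro v hv
    split_ifs <;> omega
  · intro u hu v hv huv
    have h1 := Nat.mul_le_mul_right M (h.adj u hu v hv huv)
    split_ifs with huH hvH hvH
    · omega
    · rw [← h.single v hv hvH] at h1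
      omega
    · have := hdlt u hu huH
      omega
    · have h2 := hsame u hu huH v hv hvH huv
      have h3 := h.lo_eq_of_mem_compSet (h2 ▸ hmem v : v ∈ comp u)
      have h4 := (hD u hu huH).adj u (hmem u) v (h2 ▸ hmem v) huv
      rw [h2, h3]
      omega
  · intro u hu v hv huv
    split_ifs with huH hvH hvH
    · omega
    · omega
    · have h1 : u ∈ G.innerBoundary (comp u) :=
        ⟨hmem u, v, fun hvc => (compSet_subset (A := C \ H) ⟨hu, huH⟩ hvc).2 hvH, huv.symm⟩
      have := (hD u hu huH).boundary u h1
      omega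
    · have h2 := hsame u hu huH v hv hvH huv
      have h4 := (hD u hu huH).layer_adj u (hmem u) v (h2 ▸ hmem v) huv
      rw [h2]
      omega
  · intro v hv
    rw [if_pos (h.focus v hv.1 hv)]
  · intro τ k
    -- Layer `1` is exactly `H`, because inner layers start at `1` and are shifted up. In a higher
    -- layer only one component is active at time `τ`.
    by_cases hk : k = 1
    · refine (Set.ncard_le_ncard ?_ (Set.toFinite _)).trans (h.card (τ / M))
      rintro v ⟨hv, h1, h2, h3⟩
      have hvH : v ∈ H := by
        by_contra hvH
        rw [if_neg hvH] at h1
        have := (hD v hv hvH).pos v (hmem v)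
        omega
      rw [if_pos hvH] at h2 h3
      refine ⟨hvH, (Nat.le_div_iff_mul_le hMpos).2 h2, Nat.le_of_lt_succ ?_⟩
      rw [Nat.div_lt_iff_lt_mul hMpos, Nat.succ_mul]
      omega
    · have key : ∀ v ∈ C, (if v ∈ H then 1 else dla (comp v) v + 1) = k →
          (if v ∈ H then lo v * M else lo v * M + (c (comp v) * K + dlo (comp v) v)) ≤ τ →
          τ ≤ (if v ∈ H then hi v * M + (M - 1) else
            lo v * M + (c (comp v) * K + dhi (comp v) v)) →
          v ∉ H ∧ dla (comp v) v = k - 1 ∧ τ % M / K = c (comp v) ∧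
            dlo (comp v) v ≤ τ % M % K ∧ τ % M % K ≤ dhi (comp v) v := by
        intro v hv h1 h2 h3
        have hvH : v ∉ H := fun hvH => hk (by rw [← h1, if_pos hvH])
        rw [if_neg hvH] at h1 h2 h3
        obtain ⟨-, h4, h5⟩ := div_mod_of_mem_block (hcM _ v) h2 h3
        obtain ⟨h6, h7, h8⟩ := div_mod_of_mem_block (hBK (comp v) v) h4 h5
        exact ⟨hvH, by omega, h6, h7, h8⟩
      rcases Set.eq_empty_or_nonempty {v | v ∈ C ∧
        (if v ∈ H then 1 else dla (comp v) v + 1) = k ∧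
          (if v ∈ H then lo v * M else lo v * M + (c (comp v) * K + dlo (comp v) v)) ≤ τ ∧
          τ ≤ (if v ∈ H then hi v * M + (M - 1) else
            lo v * M + (c (comp v) * K + dhi (comp v) v))} with hem | ⟨v₀, hv₀, k1, k2, k3⟩
      · rw [hem, Set.ncard_empty]
        exact Nat.zero_le _
      · obtain ⟨k4, -, k5, -, -⟩ := key v₀ hv₀ k1 k2 k3
        refine (Set.ncard_le_ncard ?_ (Set.toFinite _)).trans
          ((hD v₀ hv₀ k4).card (τ % M % K) (k - 1))
        rintro v ⟨hv, h1, h2, h3⟩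
        obtain ⟨-, h5, h6, h7, h8⟩ := key v hv h1 h2 h3
        have heq : comp v = comp v₀ := hcinj _ _ (h6.symm.trans k5)
        rw [heq] at h5 h7 h8
        exact ⟨heq ▸ hmem v, h5, h7, h8⟩

/-- If every set `C` with connected complement has a path decomposition focused on its boundary,
then `G[C]` has a layered path decomposition. -/
theorem exists_isLayered [Finite V] {G : SimpleGraph V} (hG : G.Preconnected) {N : ℕ}
    (hgood : ∀ C : Set V, G.ConnSet Cᶜ → Cᶜ.Nonempty →
      (G.inside C).Good (G.innerBoundary C) N Set.univ ∅) {C : Set V} (hC : G.ConnSet Cᶜ)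
    (hCne : Cᶜ.Nonempty) : ∃ lo hi layer, G.IsLayered N C lo hi layer := by
  classical
  induction hn : C.ncard using Nat.strong_induction_on generalizing C with
  | _ n ih =>
  -- With empty boundary the linkage condition is vacuous, so this simply forgets the vertices
  -- outside `C`.
  obtain ⟨lo₀, hi₀, H₀, L₀, h₀⟩ := (hgood C hC hCne).restrict (Set.subset_univ C)
    (Set.empty_subset C) (g := fun _ => ∅) ⟨by simp, by simp⟩ (by simp)
  have h₀' : G.IsFocused (G.innerBoundary C) N C ∅ lo₀ hi₀ H₀ L₀ :=
    { h₀ with adj := fun u hu v hv huv => h₀.adj u hu v hv ⟨huv, hu, hv⟩ }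
  have hex : ∃ k, ∃ lo hi H L, G.IsFocused (G.innerBoundary C) N C ∅ lo hi H L ∧ H.ncard = k :=
    ⟨_, _, _, _, _, h₀', rfl⟩
  obtain ⟨lo, hi, H, L, h, hHk⟩ := Nat.find_spec hex
  have hmin : ∀ lo' hi' H' L', G.IsFocused (G.innerBoundary C) N C ∅ lo' hi' H' L' →
      H.ncard ≤ H'.ncard := fun lo' hi' H' L' h' =>
    hHk ▸ Nat.find_min' hex ⟨lo', hi', H', L', h', rfl⟩
  refine h.exists_isLayered fun v hv => ?_
  -- By connectedness of `G` the boundary of `C` is non-empty. Hence so is `H`, and the components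
  -- of `C \ H` are smaller than `C`.
  have hHne : ∃ x, x ∈ H := by
    by_contra! hno
    obtain ⟨r, hr⟩ := hCne
    refine hr ((hG v r).mem_of_closed hv.1 fun a ha b hab => ?_)
    by_contra hb
    exact hno a (h.focus a ha ⟨ha, b, hb, hab.symm⟩)
  obtain ⟨x, hx⟩ := hHne
  have hsub : G.compSet (C \ H) v ⊆ C \ H := compSet_subset hv
  refine ih _ ?_ (h.connSet_compl_compSet hG hC hCne hmin hv) ⟨x, fun hxD => (hsub hxD).2 hx⟩ rfl
  rw [← hn]
  exact Set.ncard_lt_ncard ⟨hsub.trans Set.sdiff_subset, fun hs => (hsub (hs (h.subset hx))).2 hx⟩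
    (Set.toFinite _)

/-! ### From layered intervals to pathwidth -/

/-- A set of consecutive vertices of a path is connected. -/
theorem pathGraph_induce_preconnected {n : ℕ} {s : Set (Fin n)} (hs : s.OrdConnected) :
    ((pathGraph n).induce s).Preconnected := by
  have key : ∀ d : ℕ, ∀ a b : s, (a : Fin n).val + d = (b : Fin n).val →
      ((pathGraph n).induce s).Reachable a b := by
    intro d
    induction d with
    | zero =>
      intro a b hab
      have : a = b := Subtype.ext (Fin.ext hab)
      rw [this]
    | succ d ih =>
      intro a b hab
      have hlt : (a : Fin n).val + d < n := by have := (b : Fin n).2; omega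
      have hmem : (⟨(a : Fin n).val + d, hlt⟩ : Fin n) ∈ s :=
        hs.out a.2 b.2 ⟨Fin.le_def.2 (by simp), Fin.le_def.2 (by simp; omega)⟩
      refine (ih a ⟨_, hmem⟩ rfl).trans (Adj.reachable ?_)
      rw [comap_adj, pathGraph_adj]
      left
      simp only [Function.Embedding.subtype_apply]
      omega
  intro a b
  rcases le_total (a : Fin n).val (b : Fin n).val with h | h
  · exact key _ a b (Nat.add_sub_cancel' h)
  · exact (key _ b a (Nat.add_sub_cancel' h)).symm

/-- An interval representation gives a path decomposition. -/
theorem pathwidth_le_of_intervals [Finite V] {G : SimpleGraph V} {lo hi : V → ℕ} {k : ℕ}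
    (hle : ∀ v, lo v ≤ hi v) (hadj : ∀ u v, G.Adj u v → lo u ≤ hi v)
    (hk : ∀ t, {v | lo v ≤ t ∧ t ≤ hi v}.ncard ≤ k) : G.pathwidth ≤ (k : ℤ) - 1 := by
  classical
  have := Fintype.ofFinite V
  obtain ⟨m, hm⟩ := (Set.finite_range hi).bddAbove
  have hm' : ∀ v, hi v ≤ m := fun v => hm ⟨v, rfl⟩
  let D : PathDecomposition G :=
    { m := m
      bag := fun i => Finset.univ.filter fun v => lo v ≤ i ∧ i ≤ hi v
      edge_mem_bag := fun u v huv => by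
        have h1 := hadj u v huv
        have h2 := hadj v u huv.symm
        have h3 := hle u
        have h4 := hle v
        refine ⟨⟨max (lo u) (lo v), ?_⟩, ?_, ?_⟩
        · have := hm' u
          omega
        · simp; omega
        · simp; omega
      connected := fun v => by
        have hne : Nonempty {i : Fin (m + 1) |
            v ∈ Finset.univ.filter fun v => lo v ≤ i ∧ i ≤ hi v} :=
          ⟨⟨⟨lo v, by have := hm' v; have := hle v; omega⟩, by simpa using hle v⟩⟩
        refine ⟨pathGraph_induce_preconnected ⟨fun a ha b hb c hc => ?_⟩⟩
        simp only [Finset.mem_filter, Finset.mem_univ, true_and, Set.mem_ofPred_eq] at ha hb ⊢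
        exact ⟨ha.1.trans (Fin.le_def.1 hc.1), (Fin.le_def.1 hc.2).trans hb.2⟩ }
  refine ((isLeast_pathwidth G).2 ⟨D, rfl⟩).trans ?_
  have hsup : (Finset.univ.sup fun i => (D.bag i).card) ≤ k := by
    refine Finset.sup_le fun i _ => ?_
    refine le_trans (le_of_eq ?_) (hk i)
    rw [← Set.ncard_coe_finset]
    congr 1
    ext v
    simp [D]
  simp only [PathDecomposition.width]
  omega

/-- A layered path decomposition of `G` minus a vertex yields a bound on the pathwidth. -/
theorem IsLayered.pathwidth_le [Finite V] {G : SimpleGraph V} (hG : G.Preconnected) {N : ℕ}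
    (hN : 1 ≤ N) {r : V} {lo hi layer : V → ℕ} (h : G.IsLayered N {r}ᶜ lo hi layer) :
    G.pathwidth ≤ (N : ℤ) * (G.diam + 1) - 1 := by
  classical
  have := Fintype.ofFinite V
  have : Nonempty V := ⟨r⟩
  obtain ⟨m, hm⟩ := (Set.finite_range hi).bddAbove
  have hm' : ∀ v, hi v ≤ m := fun v => hm ⟨v, rfl⟩
  have hne : ∀ {v}, v ≠ r → v ∈ ({r} : Set V)ᶜ := fun h => by simpa using h
  -- The vertex `r` joins every bag and forms layer `0`, so `ly v` is at most the distance from `r`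
  -- to `v`.
  set ly : V → ℕ := fun v => if v = r then 0 else layer v with hly
  have hstep : ∀ u v, G.Adj u v → ly v ≤ ly u + 1 := by
    intro u v huv
    simp only [hly]
    split_ifs with hv hu hu
    · omega
    · omega
    · subst hu
      rw [h.boundary v ⟨hne hv, u, by simp, huv⟩]
    · exact h.layer_adj v (hne hv) u (hne hu) huv.symm
  have hwalk : ∀ u v (p : G.Walk u v), ly v ≤ ly u + p.length := by
    intro u v p
    induction p with
    | nil => simp
    | cons hab _ ih =>
      have := hstep _ _ hab
      rw [Walk.length_cons]
      omega
  have hdiam : ∀ v, ly v < G.diam + 1 := by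
    intro v
    obtain ⟨p, hp⟩ := (hG r v).exists_walk_length_eq_dist
    have h1 := hwalk r v p
    have h2 : G.dist r v ≤ G.diam := dist_le_diam (connected_iff_ediam_ne_top.1 ⟨hG⟩)
    have h3 : ly r = 0 := by simp [hly]
    omega
  have key := pathwidth_le_of_intervals (G := G) (lo := fun v => if v = r then 0 else lo v)
    (hi := fun v => if v = r then m else hi v) (k := (G.diam + 1) * N) ?_ ?_ ?_
  · push_cast at key
    rwa [mul_comm] at key
  · intro v
    split_ifs with hv
    · exact Nat.zero_le _
    · exact h.lo_le v (hne hv)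
  · intro u v huv
    split_ifs with hu hv hv
    · exact Nat.zero_le _
    · exact Nat.zero_le _
    · exact (h.lo_le u (hne hu)).trans (hm' u)
    · exact h.adj u (hne hu) v (hne hv) huv
  · intro t
    rw [Set.ncard_eq_toFinset_card']
    rw [Finset.card_eq_sum_card_fiberwise (f := ly) (t := Finset.range (G.diam + 1))
      fun v _ => by simpa using hdiam v]
    refine (Finset.sum_le_card_nsmul _ _ N fun k _ => ?_).trans (by simp)
    rw [← Set.ncard_coe_finset]
    rcases Nat.eq_zero_or_pos k with rfl | hk
    · refine (Set.ncard_le_ncard (t := {r}) ?_ (Set.toFinite _)).trans (by simpa using hN)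
      intro v hv
      by_contra hvr
      have hvr : v ≠ r := hvr
      have h1 := h.pos v (hne hvr)
      simp [hly, hvr] at hv
      omega
    · refine (Set.ncard_le_ncard ?_ (Set.toFinite _)).trans (h.card t k)
      intro v hv
      have hvr : v ≠ r := by
        rintro rfl
        simp [hly] at hv
        omega
      simp [hly, hvr] at hv
      exact ⟨hne hvr, hv.2, hv.1.1, hv.1.2⟩

/-! ### The apex vertex and the main theorem -/

/-- A model of `X` minus a vertex all of whose branch sets meet the boundary of a set `C` with
connected complement gives a model of `X`. -/
theorem isMinor_of_rooted {X : SimpleGraph W} {G : SimpleGraph V} {a : W} {C : Set V}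
    (hC : G.ConnSet Cᶜ) (hCne : Cᶜ.Nonempty) {B : {w // w ≠ a} → Set V}
    (hB : ∀ w, (G.inside C).ConnSet (B w) ∧ (B w ∩ G.innerBoundary C).Nonempty)
    (hd : ∀ w w', w ≠ w' → Disjoint (B w) (B w'))
    (hadj : ∀ w w' : {w // w ≠ a}, X.Adj w w' → ∃ u ∈ B w, ∃ v ∈ B w', G.Adj u v) :
    X.IsMinor G := by
  classical
  have hBC : ∀ w, B w ⊆ C := fun w => by
    obtain ⟨x, hx, hxC⟩ := (hB w).2
    exact (hB w).1.subset_of_inside hx hxC.1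
  have hBadj : ∀ w, ∃ u ∈ B w, ∃ v ∈ Cᶜ, G.Adj u v := fun w => by
    obtain ⟨x, hx, -, y, hy, hxy⟩ := (hB w).2
    exact ⟨x, hx, y, hy, hxy.symm⟩
  have hBd : ∀ w, Disjoint (B w) Cᶜ := fun w => by
    rw [Set.disjoint_compl_right_iff_subset]
    exact hBC w
  -- Every `B w` has an edge to `Cᶜ`, so it does not matter which vertices are adjacent to `a`.
  refine ⟨fun w => if h : w = a then Cᶜ else B ⟨w, h⟩, ?_, ?_, ?_⟩
  · intro x y hxy
    split_ifs with hx hy hy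
    · exact absurd (hx.trans hy.symm) hxy
    · exact (hBd _).symm
    · exact hBd _
    · exact hd _ _ fun h => hxy (congrArg Subtype.val h)
  · intro x
    by_cases hx : x = a
    · rw [dif_pos hx]
      exact hC.connected_induce hCne
    · rw [dif_neg hx]
      exact ((hB _).1.mono (inside_le _ _)).connected_induce ((hB _).2.mono Set.inter_subset_left)
  · intro x y hxy
    split_ifs with hx hy hy
    · exact absurd (hx.trans hy.symm) hxy.ne
    · obtain ⟨u, hu, v, hv, huv⟩ := hBadj ⟨y, hy⟩
      exact ⟨v, hv, u, hu, huv.symm⟩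
    · exact hBadj ⟨x, hx⟩
    · exact hadj ⟨x, hx⟩ ⟨y, hy⟩ hxy

/-- A non-null apex-forest has a vertex whose removal leaves a forest. -/
theorem IsApexForest.exists_apex [Nonempty W] {X : SimpleGraph W} (hX : X.IsApexForest) :
    ∃ a, (X.comap (Subtype.val : {w // w ≠ a} → W)).IsAcyclic := by
  obtain ⟨S, hS, hac⟩ := hX
  have hex : ∃ a, S ⊆ {a} := by
    rcases hS.eq_empty_or_singleton with rfl | ⟨a, rfl⟩
    · exact ⟨Classical.arbitrary W, Set.empty_subset _⟩
    · exact ⟨a, subset_rfl⟩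
  obtain ⟨a, ha⟩ := hex
  refine ⟨a, hac.comap (f := ⟨fun w => ⟨w.1, fun h => w.2 (ha h)⟩, fun h => h⟩) ?_⟩
  intro w w' h
  exact Subtype.ext (congrArg (fun x : ↥Sᶜ => (x : W)) h)

end SimpleGraph

theorem mainTheorem8 {W V : Type*} [Finite W] [Finite V]
    (X : SimpleGraph W) (G : SimpleGraph V)
    (hX : X.IsApexForest) (hcard : 2 ≤ Nat.card W)
    (hconn : G.Preconnected) (hfree : SimpleGraph.MinorFree X G) :
    G.pathwidth ≤ (2 * (Nat.card W : ℤ) - 3) * ((G.diam : ℤ) + 1) - 1 := by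
  classical
  have hW : Nontrivial W := Finite.one_lt_card_iff_nontrivial.1 hcard
  -- The tree has `|W| - 1` vertices, and `2(|W| - 1) - 1 = 2|W| - 3`.
  obtain ⟨N, hN⟩ : ∃ N, N + 3 = 2 * Nat.card W := ⟨2 * Nat.card W - 3, by omega⟩
  have hN' : 2 * (Nat.card W : ℤ) - 3 = N := by omega
  rw [hN']
  rcases isEmpty_or_nonempty V with hV | ⟨⟨r⟩⟩
  · have h := SimpleGraph.pathwidth_le_of_intervals (G := G) (lo := fun _ => 0) (hi := fun _ => 0)
      (k := 0) (by simp) (by simp) (by simp [Set.eq_empty_of_isEmpty])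
    have : 0 ≤ (N : ℤ) * ((G.diam : ℤ) + 1) := by positivity
    push_cast at h
    linarith
  obtain ⟨a, ha⟩ := hX.exists_apex
  obtain ⟨b, hb⟩ := exists_ne a
  have hne : Nonempty {w // w ≠ a} := ⟨⟨b, hb⟩⟩
  have hcW : Nat.card {w // w ≠ a} + 1 = Nat.card W := by
    have h1 := Set.ncard_add_ncard_compl ({a} : Set W)
    rw [Set.ncard_singleton, ← Nat.card_coe_set_eq] at h1
    rw [← h1, add_comm]
    rfl
  -- A spanning tree of the complete graph that contains the forest; a model of it is also a model
  -- of the forest.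
  obtain ⟨F, hF, -, hT⟩ := SimpleGraph.connected_top.exists_isTree_le_of_le_of_isAcyclic le_top ha
  have hgood : ∀ C : Set V, G.ConnSet Cᶜ → Cᶜ.Nonempty →
      (G.inside C).Good (G.innerBoundary C) N Set.univ ∅ := by
    intro C hC hCne
    refine SimpleGraph.good_univ_of_not_rooted hT (by omega) ?_
    rintro ⟨B, hB, hd, hadj⟩
    refine hfree (SimpleGraph.isMinor_of_rooted hC hCne hB hd fun w w' hww => ?_)
    obtain ⟨u, hu, v, hv, huv⟩ := hadj w w' (hF hww)
    exact ⟨u, hu, v, hv, huv.1⟩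
  obtain ⟨lo, hi, layer, h⟩ := SimpleGraph.exists_isLayered hconn hgood (C := {r}ᶜ)
    (by rw [compl_compl]; exact SimpleGraph.connSet_singleton G r) (by simp)
  exact h.pathwidth_le hconn (by omega)
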